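/- Let $\mathbb{R}^n=\mathbb{R}^{n_1}\times\dots\times\mathbb{R}^{n_j}$ with integers $n_1,\dots,n_j\ge 1$, and let $\mathbf{s}=(s_1,\dots,s_j)\in\mathbb{R}^j$. For $\xi=(\xi_1,\dots,\xi_j)$ with $\xi_l\in\mathbb{R}^{n_l}$ put $\langle\langle\xi\rangle\rangle^{\mathbf{s}}=\prod_{l=1}^{j}(1+|\xi_l|^2)^{s_l/2}$, and let $\langle\langle D\rangle\rangle^{\mathbf{s}}=(1-\Delta_{\mathbb{R}^{n_1}})^{s_1/2}\otimes\dots\otimes(1-\Delta_{\mathbb{R}^{n_j}})^{s_j/2}$ be the corresponding Fourier multiplier on $\mathcal{S}'(\mathbb{R}^n)$. Define $$\mathcal{H}^{\mathbf{s}}(\mathbb{R}^n)=\{u\in\mathcal{S}'(\mathbb{R}^n):\langle\langle D\rangle\rangle^{\mathbf{s}}u\in L^2(\mathbb{R}^n)\},\qquad \|u\|_{\mathcal{H}^{\mathbf{s}}}=\|\langle\langle D\rangle\rangle^{\mathbf{s}}u\|_{L^2},$$ where $\mathcal{S}'(\mathbb{R}^n)$ is regarded as a subspace of the space $\mathcal{D}'(\mathbb{R}^n)$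 of complex distributions. For $\chi\in C_0^\infty(\mathbb{R}^n)$ (complex-valued) and $y\in\mathbb{R}^n$ put $\tau_y\chi=\chi(\cdot-y)$. Let $\mathcal{K}_2^{\mathbf{s}}(\mathbb{R}^n)$ be the set of all $u\in\mathcal{D}'(\mathbb{R}^n)$ for which there is $\chi\in C_0^\infty(\mathbb{R}^n)\setminus\{0\}$ such that $u\,\tau_y\chi\in\mathcal{H}^{\mathbf{s}}(\mathbb{R}^n)$ for every $y\in\mathbb{R}^n$ and the function $y\mapsto\|u\,\tau_y\chi\|_{\mathcal{H}^{\mathbf{s}}}$ belongs to $L^2(\mathbb{R}^n)$. For $\chi\in C_0^\infty(\mathbb{R}^n)\setminus\{0\}$ put $$\|u\|_{\mathbf{s},2,\chi}=\Big(\int_{\mathbb{R}^n}\|u\,\tau_y\chi\|_{\mathcal{H}^{\mathbf{s}}}^2\,dy\Big)^{1/2}.$$ **Theorem.** $\mathcal{H}^{\mathbf{s}}(\mathbb{R}^n)=\mathcal{K}_2^{\mathbf{s}}(\mathbb{R}^n)$ as subsets of $\mathcal{D}'(\mathbb{R}^n)$, and the norms are equivalent: for every $\chi\in C_0^\infty(\mathbb{R}^n)\setminus\{0\}$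 there is a constant $C>0$, depending only on $\chi$, $\mathbf{s}$ and the decomposition of $\mathbb{R}^n$, such that $$C^{-1}\|u\|_{\mathcal{H}^{\mathbf{s}}}\le\|u\|_{\mathbf{s},2,\chi}\le C\|u\|_{\mathcal{H}^{\mathbf{s}}}\qquad\text{for all }u\in\mathcal{H}^{\mathbf{s}}(\mathbb{R}^n).$$ -/

import Mathlib

open MeasureTheory TopologicalSpace
open scoped Distributions SchwartzMap ENNReal NNReal ContDiff

noncomputable section

namespace KatoSobolev

/-! ### Multiplication of a distribution by a smooth function -/

section Mul

variable {E : Type*} [NormedAddCommGroup E] [NormedSpace ℝ E] {Ω : Opens E}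

/-- The value `u (Re φ) + i u (Im φ)` of a complex distribution `u` on a complex test function `φ`,
as a continuous real-linear map in `φ`. -/
def complexify (u : 𝓓'(Ω, ℂ)) : 𝓓(Ω, ℂ) →L[ℝ] ℂ :=
  (u : 𝓓(Ω, ℝ) →L[ℝ] ℂ) ∘L TestFunction.postcompCLM Complex.reCLM +
    (ContinuousLinearMap.mul ℝ ℂ Complex.I) ∘L (u : 𝓓(Ω, ℝ) →L[ℝ] ℂ) ∘L
      TestFunction.postcompCLM Complex.imCLM

/-- `φ ↦ φ ψ` for a smooth function `ψ : E → ℂ`, from real to complex test functions. -/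
def testMul (ψ : E → ℂ) (hψ : ContDiff ℝ ∞ ψ) : 𝓓(Ω, ℝ) →L[ℝ] 𝓓(Ω, ℂ) :=
  TestFunction.limitCLM ℝ
    (fun φ ↦
      ⟨fun x ↦ φ x • ψ x, φ.contDiff.smul hψ, φ.hasCompactSupport.smul_right,
        (tsupport_smul_subset_left (φ : E → ℝ) ψ).trans φ.tsupport_subset⟩)
    (fun _ K_sub_Ω ↦ TestFunction.ofSupportedInCLM ℝ K_sub_Ω ∘L
      ContDiffMapSupportedIn.bilinLeftCLM (ContinuousLinearMap.lsmul ℝ ℝ) hψ)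
    (fun _ _ _ ↦ rfl)

/-- The product `ψ u` of a smooth function and a distribution: `⟨ψ u, φ⟩ = ⟨u, ψ φ⟩`. -/
def smoothMul (ψ : E → ℂ) (hψ : ContDiff ℝ ∞ ψ) (u : 𝓓'(Ω, ℂ)) : 𝓓'(Ω, ℂ) :=
  complexify u ∘L testMul ψ hψ

theorem smoothMul_apply (ψ : E → ℂ) (hψ : ContDiff ℝ ∞ ψ) (u : 𝓓'(Ω, ℂ)) (φ : 𝓓(Ω, ℝ)) :
    smoothMul ψ hψ u φ =
      u (TestFunction.postcompCLM Complex.reCLM (testMul ψ hψ φ)) +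
        Complex.I * u (TestFunction.postcompCLM Complex.imCLM (testMul ψ hψ φ)) :=
  rfl

/-- The translate `τ_y χ = χ (· - y)` of a test function on the whole space. -/
def translate (y : E) (χ : 𝓓((⊤ : Opens E), ℂ)) : 𝓓((⊤ : Opens E), ℂ) where
  toFun x := χ (x - y)
  contDiff' := χ.contDiff.comp (contDiff_id.sub contDiff_const)
  hasCompactSupport' := χ.hasCompactSupport.comp_homeomorph (Homeomorph.subRight y)
  tsupport_subset' := Set.subset_univ _

/-- A real test function regarded as a complex Schwartz function. -/
def testToSchwartz (φ : 𝓓((⊤ : Opens E), ℝ)) : 𝓢(E, ℂ) :=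
  HasCompactSupport.toSchwartzMap (f := fun x ↦ (φ x : ℂ))
    (φ.hasCompactSupport.comp_left Complex.ofReal_zero)
    (Complex.ofRealCLM.contDiff.comp φ.contDiff)

/-- `u` is the distribution defined by the tempered distribution `v`. -/
def IsRestriction (v : 𝓢'(E, ℂ)) (u : 𝓓'((⊤ : Opens E), ℂ)) : Prop :=
  ∀ φ : 𝓓((⊤ : Opens E), ℝ), u φ = v (testToSchwartz φ)

end Mul

/-! ### Sobolev spaces of multiple order

The decomposition `ℝⁿ = ℝ^{n₁} × ⋯ × ℝ^{n_j}` is given by a composition `c` of `n`, so that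
`j = c.length` and `n_l = c.blocksFun l ≥ 1`. -/

variable {n : ℕ}

/-- The component of `ξ` in the `l`-th factor of `ℝⁿ = ℝ^{n₁} × ⋯ × ℝ^{n_j}`. -/
def blockPart (c : Composition n) (l : Fin c.length) (ξ : EuclideanSpace ℝ (Fin n)) :
    EuclideanSpace ℝ (Fin (c.blocksFun l)) :=
  WithLp.toLp 2 fun k ↦ ξ (c.embedding l k)

/-- `⟨⟨ξ⟩⟩^s = ∏ l, (1 + |ξ_l|²)^{s_l / 2}`. -/
def multiBracket (c : Composition n) (s : Fin c.length → ℝ) (ξ : EuclideanSpace ℝ (Fin n)) : ℝ :=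
  ∏ l, (1 + ‖blockPart c l ξ‖ ^ 2) ^ (s l / 2)

theorem multiBracket_hasTemperateGrowth (c : Composition n) (s : Fin c.length → ℝ) :
    (fun ξ ↦ ((multiBracket c s ((2 * Real.pi) • ξ) : ℝ) : ℂ)).HasTemperateGrowth := by
  have h1 : ∀ l : Fin c.length, (fun ξ : EuclideanSpace ℝ (Fin n) ↦
      (((1 + ‖blockPart c l ((2 * Real.pi) • ξ)‖ ^ 2) ^ (s l / 2) : ℝ) :
        ℂ)).HasTemperateGrowth := by
    intro l
    let L : EuclideanSpace ℝ (Fin n) →ₗ[ℝ] EuclideanSpace ℝ (Fin (c.blocksFun l)) :=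
      { toFun := fun ξ ↦ blockPart c l ((2 * Real.pi) • ξ)
        map_add' := fun x y ↦ by ext k; simp [blockPart]
        map_smul' := fun a x ↦ by ext k; simp [blockPart]; ring }
    exact Function.Complex.hasTemperateGrowth_ofReal.comp
      ((Function.hasTemperateGrowth_one_add_norm_sq_rpow _ (s l / 2)).comp
        L.toContinuousLinearMap.hasTemperateGrowth)
  have h2 : ∀ t : Finset (Fin c.length), (fun ξ : EuclideanSpace ℝ (Fin n) ↦
      ∏ l ∈ t, (((1 + ‖blockPart c l ((2 * Real.pi) • ξ)‖ ^ 2) ^ (s l / 2) : ℝ) :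
        ℂ)).HasTemperateGrowth := by
    intro t
    induction t using Finset.induction_on with
    | empty => simp
    | insert l t hl ih =>
      simp only [Finset.prod_insert hl]
      exact (h1 l).mul ih
  simpa [multiBracket] using h2 Finset.univ

/-- `⟨⟨D⟩⟩^s = (1 - Δ_{ℝ^{n₁}})^{s₁/2} ⊗ ⋯ ⊗ (1 - Δ_{ℝ^{n_j}})^{s_j/2}` on tempered distributions.
The factor `2π` appears because the Fourier transform is taken with the kernel `exp (-2πi⟨x, ξ⟩)`,
for which `1 - Δ` has the symbol `1 + |2πξ|²`. -/
def multiBessel (c : Composition n) (s : Fin c.length → ℝ) :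
    𝓢'(EuclideanSpace ℝ (Fin n), ℂ) →L[ℂ] 𝓢'(EuclideanSpace ℝ (Fin n), ℂ) :=
  TemperedDistribution.fourierMultiplierCLM ℂ
    fun ξ ↦ ((multiBracket c s ((2 * Real.pi) • ξ) : ℝ) : ℂ)

/-- `u` is (the restriction to test functions of) a tempered distribution `v` such that
`⟨⟨D⟩⟩^s v` is the function `f` of `L²(ℝⁿ)`. -/
def HasBessel (c : Composition n) (s : Fin c.length → ℝ)
    (u : 𝓓'((⊤ : Opens (EuclideanSpace ℝ (Fin n))), ℂ))
    (f : Lp ℂ 2 (volume : Measure (EuclideanSpace ℝ (Fin n)))) : Prop :=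
  ∃ v : 𝓢'(EuclideanSpace ℝ (Fin n), ℂ), IsRestriction v u ∧ multiBessel c s v = f

/-- The Sobolev space `ℋ^s(ℝⁿ)`, as a subset of the space of all distributions on `ℝⁿ`. -/
def sobolevSpace (c : Composition n) (s : Fin c.length → ℝ) :
    Set 𝓓'((⊤ : Opens (EuclideanSpace ℝ (Fin n))), ℂ) :=
  {u | ∃ f, HasBessel c s u f}

/-- The norm `‖u‖_{ℋ^s} = ‖⟨⟨D⟩⟩^s u‖_{L²}`, with value `∞` if `u` is not in `ℋ^s`.
(There is at most one `f` in the infimum.) -/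
def sobolevENorm (c : Composition n) (s : Fin c.length → ℝ)
    (u : 𝓓'((⊤ : Opens (EuclideanSpace ℝ (Fin n))), ℂ)) : ℝ≥0∞ :=
  ⨅ (f : Lp ℂ 2 (volume : Measure (EuclideanSpace ℝ (Fin n)))) (_ : HasBessel c s u f), ‖f‖ₑ

theorem mem_sobolevSpace_iff (c : Composition n) (s : Fin c.length → ℝ)
    (u : 𝓓'((⊤ : Opens (EuclideanSpace ℝ (Fin n))), ℂ)) :
    u ∈ sobolevSpace c s ↔ sobolevENorm c s u ≠ ⊤ := by
  simp only [sobolevSpace, sobolevENorm, Set.mem_ofPred_eq, ne_eq, iInf_eq_top, not_forall]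
  exact ⟨fun ⟨f, hf⟩ ↦ ⟨f, hf, enorm_ne_top⟩, fun ⟨f, hf, _⟩ ↦ ⟨f, hf⟩⟩

/-! ### Kato–Sobolev spaces -/

/-- The product `u τ_y χ`. -/
def localize (χ : 𝓓((⊤ : Opens (EuclideanSpace ℝ (Fin n))), ℂ)) (y : EuclideanSpace ℝ (Fin n))
    (u : 𝓓'((⊤ : Opens (EuclideanSpace ℝ (Fin n))), ℂ)) :
    𝓓'((⊤ : Opens (EuclideanSpace ℝ (Fin n))), ℂ) :=
  smoothMul (translate y χ) (translate y χ).contDiff u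

/-- The norm `‖u‖_{s,p,χ}`, i.e. the `L^p` norm of `y ↦ ‖u τ_y χ‖_{ℋ^s}`. -/
def katoENorm (c : Composition n) (s : Fin c.length → ℝ) (p : ℝ≥0∞)
    (χ : 𝓓((⊤ : Opens (EuclideanSpace ℝ (Fin n))), ℂ))
    (u : 𝓓'((⊤ : Opens (EuclideanSpace ℝ (Fin n))), ℂ)) : ℝ≥0∞ :=
  eLpNorm (fun y ↦ sobolevENorm c s (localize χ y u)) p volume

/-- The Kato–Sobolev space `𝒦_p^s(ℝⁿ)`: the distributions `u` for which there is a nonzero test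
function `χ` such that `u τ_y χ ∈ ℋ^s` for all `y` and `y ↦ ‖u τ_y χ‖_{ℋ^s}` is in `L^p`. -/
def katoSobolevSpace (c : Composition n) (s : Fin c.length → ℝ) (p : ℝ≥0∞) :
    Set 𝓓'((⊤ : Opens (EuclideanSpace ℝ (Fin n))), ℂ) :=
  {u | ∃ χ : 𝓓((⊤ : Opens (EuclideanSpace ℝ (Fin n))), ℂ), χ ≠ 0 ∧
    (∀ y, localize χ y u ∈ sobolevSpace c s) ∧
    MemLp (fun y ↦ sobolevENorm c s (localize χ y u)) p volume}

end KatoSobolev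

end

noncomputable section

namespace KatoSobolev

open FourierTransform

/-! ### Preliminaries on `L²` -/

section LTwo

/-! Everything takes place on the Fourier side. Let `w` be the weight `⟨⟨2πξ⟩⟩^s`; a distribution
`u` lies in `ℋ^s` exactly when its Fourier transform is `h / w` with `h ∈ L²`, and then its norm is
`‖h‖₂`. Multiplication by a test function `ψ` turns `h` into `symbolMul w a h`, an integral operator
with kernel `w(η) w(ξ)⁻¹ a(ξ - η)`, where `a` is the inverse transform of `ψ`.

Norm equivalence. Translating `χ` by `y` multiplies `a(ζ)` by `e^{2πi⟨y,ζ⟩}`, so for fixed `η` the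
new symbol is an inverse Fourier transform in the variable `y`. Plancherel in `y` and Tonelli give
`∫ ‖u τ_y χ‖² dy = ∫ |h(ξ)|² ∫ |w(η) w(ξ)⁻¹ a(ξ - η)|² dη dξ` (`lintegral_symbolMul_modulate`).
Peetre's inequality bounds `w(η) / w(ξ)` above and below by `m(ξ - η)` and its inverse, so the inner
integral lies between two positive finite constants (`exists_norm_equiv`). This also yields `ℋ^s ⊆
𝒦_2^s`.

Reverse inclusion. The equivalence is available only for elements of `ℋ^s`, so `u ∈ 𝒦_2^s` is first
cut off. A partition argument puts `ψ u` in `ℋ^s` for every test function `ψ`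
(`smoothMul_mem_sobolevSpace_of_localize`). For the dilated cutoffs `ψ(x / R)`, `R ≥ 1`, the
multiplier bounds are uniform in `R` (`lintegral_dilate_le`), so the cut-off distributions are
bounded in `ℋ^s`, and a weak limit of their symbols is a symbol of `u`. -/

theorem eLpNorm_two_sq {α ε : Type*} [MeasurableSpace α] [ENorm ε] (μ : Measure α) (f : α → ε) :
    eLpNorm f 2 μ ^ 2 = ∫⁻ x, ‖f x‖ₑ ^ 2 ∂μ := by
  have h := eLpNorm_nnreal_pow_eq_lintegral (f := f) (μ := μ) (p := 2) two_ne_zero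
  simpa using h

theorem lintegral_mul_sq_le {α : Type*} [MeasurableSpace α] (μ : Measure α) {f g : α → ℝ≥0∞}
    (hf : AEMeasurable f μ) (hg : AEMeasurable g μ) :
    (∫⁻ x, f x * g x ∂μ) ^ 2 ≤ (∫⁻ x, f x ^ 2 ∂μ) * ∫⁻ x, g x ^ 2 ∂μ := by
  have h := ENNReal.lintegral_mul_le_Lp_mul_Lq μ Real.HolderConjugate.two_two hf hg
  have h2 : ∀ a : ℝ≥0∞, (a ^ (1 / (2 : ℝ))) ^ 2 = a := fun a ↦ by
    rw [← ENNReal.rpow_natCast, ← ENNReal.rpow_mul]; norm_num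
  calc _ ≤ _ := pow_le_pow_left' h 2
    _ = _ := by rw [mul_pow, h2, h2]; simp

variable {E : Type*} [NormedAddCommGroup E] [MeasurableSpace E] [BorelSpace E]
  [SecondCountableTopology E] {μ : Measure E} [SFinite μ] [μ.IsAddHaarMeasure]
  [μ.IsNegInvariant]

/-- A case of Young's inequality. -/
theorem lintegral_sq_lintegral_mul_sub_le {f g : E → ℝ≥0∞} (hf : Measurable f)
    (hg : Measurable g) :
    ∫⁻ y, (∫⁻ x, f x * g (x - y) ∂μ) ^ 2 ∂μ ≤ (∫⁻ x, g x ∂μ) ^ 2 * ∫⁻ x, f x ^ 2 ∂μ := by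
  have hsq : ∀ a : ℝ≥0∞, (a ^ (1 / (2 : ℝ))) ^ 2 = a := fun a ↦ by
    rw [← ENNReal.rpow_natCast, ← ENNReal.rpow_mul]; norm_num
  -- Cauchy–Schwarz after splitting `g = g^{1/2} · g^{1/2}`.
  have h1 : ∀ y, (∫⁻ x, f x * g (x - y) ∂μ) ^ 2 ≤
      (∫⁻ x, g x ∂μ) * ∫⁻ x, f x ^ 2 * g (x - y) ∂μ := by
    intro y
    have hgy : Measurable fun x ↦ g (x - y) ^ (1 / (2 : ℝ)) :=
      (hg.comp (measurable_id.sub_const y)).pow_const _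
    calc (∫⁻ x, f x * g (x - y) ∂μ) ^ 2
        = (∫⁻ x, g (x - y) ^ (1 / (2 : ℝ)) * (f x * g (x - y) ^ (1 / (2 : ℝ))) ∂μ) ^ 2 := by
          congr 1
          refine lintegral_congr fun x ↦ ?_
          calc f x * g (x - y) = f x * (g (x - y) ^ (1 / (2 : ℝ))) ^ 2 := by rw [hsq]
            _ = _ := by ring
      _ ≤ _ := lintegral_mul_sq_le μ hgy.aemeasurable (hf.mul hgy).aemeasurable
      _ = _ := by
          simp only [mul_pow, hsq]
          rw [lintegral_sub_right_eq_self g y]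
  calc _ ≤ ∫⁻ y, (∫⁻ x, g x ∂μ) * ∫⁻ x, f x ^ 2 * g (x - y) ∂μ ∂μ := lintegral_mono h1
    _ = (∫⁻ x, g x ∂μ) * ∫⁻ y, ∫⁻ x, f x ^ 2 * g (x - y) ∂μ ∂μ := by
        refine lintegral_const_mul _ (Measurable.lintegral_prod_right' (f := fun p : E × E ↦
          f p.2 ^ 2 * g (p.2 - p.1)) ?_)
        fun_prop
    _ = (∫⁻ x, g x ∂μ) * ∫⁻ x, ∫⁻ y, f x ^ 2 * g (x - y) ∂μ ∂μ := by
        rw [lintegral_lintegral_swap]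
        apply Measurable.aemeasurable
        fun_prop
    _ = (∫⁻ x, g x ∂μ) * ∫⁻ x, f x ^ 2 * ∫⁻ x, g x ∂μ ∂μ := by
        congr 1
        refine lintegral_congr fun x ↦ ?_
        rw [lintegral_const_mul _ (by fun_prop), lintegral_sub_left_eq_self]
    _ = _ := by rw [lintegral_mul_const _ (by fun_prop)]; ring

end LTwo

/-! ### Plancherel's theorem for functions in `L¹ ∩ L²` -/

section Plancherel

variable {E : Type*} [NormedAddCommGroup E] [InnerProductSpace ℝ E] [FiniteDimensional ℝ E]
  [MeasurableSpace E] [BorelSpace E]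

theorem continuous_fourier_of_integrable {k : E → ℂ} (hk : Integrable k) : Continuous (𝓕 k) :=
  VectorFourier.fourierIntegral_continuous Real.continuous_fourierChar
    (by exact continuous_inner) hk

theorem integral_schwartz_mul_fourier (g : 𝓢(E, ℂ)) {k : E → ℂ} (hk : Integrable k) :
    ∫ ξ, 𝓕 g ξ * k ξ = ∫ x, g x * 𝓕 k x := by
  have h := VectorFourier.integral_fourierIntegral_smul_eq_flip (μ := volume) (ν := volume)
    (L := innerₗ E) (f := g) (g := k) Real.continuous_fourierChar (by exact continuous_inner)
    g.integrable hk
  rw [flip_innerₗ] at h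
  simpa only [smul_eq_mul] using! h

/-- The `L²` transform is characterized by duality with Schwartz functions, the integral by Fubini;
tested against smooth compactly supported functions, both move `𝓕` onto the test function and so
agree. -/
theorem toLp_fourier_ae_eq {k : E → ℂ} (h1 : Integrable k) (h2 : MemLp k 2) :
    (𝓕 (h2.toLp k) : Lp ℂ 2 (volume : Measure E)) =ᵐ[volume] 𝓕 k := by
  refine ae_eq_of_integral_contDiff_smul_eq ((Lp.memLp _).locallyIntegrable one_le_two)
    (continuous_fourier_of_integrable h1).locallyIntegrable fun g hg hgc ↦ ?_
  have hg₁ : HasCompactSupport (Complex.ofRealCLM ∘ g) := hgc.comp_left rfl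
  have hg₂ : ContDiff ℝ ∞ (Complex.ofRealCLM ∘ g) := Complex.ofRealCLM.contDiff.comp hg
  set G : 𝓢(E, ℂ) := hg₁.toSchwartzMap hg₂
  have hG : ∀ x, G x = g x := fun x ↦ rfl
  calc ∫ x, g x • (𝓕 (h2.toLp k) : Lp ℂ 2 (volume : Measure E)) x
      = Lp.toTemperedDistribution (𝓕 (h2.toLp k)) G := by
        rw [Lp.toTemperedDistribution_apply]; simp [hG]
    _ = Lp.toTemperedDistribution (h2.toLp k) (𝓕 G) := by
        rw [← Lp.fourier_toTemperedDistribution_eq, TemperedDistribution.fourier_apply]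
    _ = ∫ x, 𝓕 G x * k x := by
        rw [Lp.toTemperedDistribution_apply]
        refine integral_congr_ae ?_
        filter_upwards [h2.coeFn_toLp] with x hx
        rw [hx, smul_eq_mul]
    _ = ∫ x, G x * 𝓕 k x := integral_schwartz_mul_fourier G h1
    _ = _ := by simp [hG]

theorem lintegral_enorm_fourier_sq {k : E → ℂ} (h1 : Integrable k) (h2 : MemLp k 2) :
    ∫⁻ y, ‖𝓕 k y‖ₑ ^ 2 = ∫⁻ x, ‖k x‖ₑ ^ 2 := by
  rw [← eLpNorm_two_sq, ← eLpNorm_two_sq, ← eLpNorm_congr_ae (toLp_fourier_ae_eq h1 h2),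
    ← eLpNorm_congr_ae h2.coeFn_toLp, ← Lp.enorm_def, ← Lp.enorm_def, ← ofReal_norm,
    Lp.norm_fourier_eq, ofReal_norm]

theorem lintegral_enorm_fourierInv_sq {k : E → ℂ} (h1 : Integrable k) (h2 : MemLp k 2) :
    ∫⁻ y, ‖𝓕⁻ k y‖ₑ ^ 2 = ∫⁻ x, ‖k x‖ₑ ^ 2 := by
  simp_rw [Real.fourierInv_eq_fourier_neg]
  rw [lintegral_neg_eq_self (f := fun y ↦ ‖𝓕 k y‖ₑ ^ 2), lintegral_enorm_fourier_sq h1 h2]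

end Plancherel

/-! ### Moderate weights and multiplication on the Fourier side -/

section Weights

variable {E : Type*} [NormedAddCommGroup E] [InnerProductSpace ℝ E]

/-- The weight `w` is moderate with respect to the even, radially increasing weight `m`. -/
structure IsModerate (w m : E → ℝ) : Prop where
  pos : ∀ ξ, 0 < w ξ
  pos' : ∀ ξ, 0 < m ξ
  growth : (fun ξ ↦ (w ξ : ℂ)).HasTemperateGrowth
  growth_inv : (fun ξ ↦ ((w ξ)⁻¹ : ℂ)).HasTemperateGrowth
  growth' : (fun ξ ↦ (m ξ : ℂ)).HasTemperateGrowth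
  even : ∀ ξ, m (-ξ) = m ξ
  le_smul : ∀ (R : ℝ) ξ, 1 ≤ R → m ξ ≤ m (R • ξ)
  add_le : ∀ ξ η, w (ξ + η) ≤ w ξ * m η

namespace IsModerate

variable {w m : E → ℝ} (hw : IsModerate w m)
include hw

theorem continuous : Continuous w :=
  Complex.continuous_re.comp hw.growth.1.continuous

theorem continuous' : Continuous m :=
  Complex.continuous_re.comp hw.growth'.1.continuous

theorem le_mul_sub (ξ η : E) : w ξ ≤ w η * m (ξ - η) := by
  simpa using hw.add_le η (ξ - η)

theorem le_mul_sub' (ξ η : E) : w η ≤ w ξ * m (ξ - η) := by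
  rw [← hw.even, neg_sub]; exact hw.le_mul_sub η ξ

theorem enorm_div_mul_le (ξ η : E) (z : ℂ) :
    ‖(w η : ℂ) * (w ξ : ℂ)⁻¹ * z‖ₑ ≤ ‖(m (ξ - η) : ℂ) * z‖ₑ := by
  have h1 := hw.pos ξ
  have h2 := hw.pos η
  have h3 := hw.pos' (ξ - η)
  rw [enorm_le_iff_norm_le, norm_mul, norm_mul, norm_mul, norm_inv, Complex.norm_real,
    Complex.norm_real, Complex.norm_real, Real.norm_of_nonneg h1.le, Real.norm_of_nonneg h2.le,
    Real.norm_of_nonneg h3.le]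
  gcongr
  rw [← div_eq_mul_inv, div_le_iff₀ h1, mul_comm]
  exact hw.le_mul_sub' ξ η

/-- The source of the lower bound in the norm equivalence; unlike the upper bound it does not need
`m` to be even. -/
theorem enorm_inv_mul_le (ξ η : E) (z : ℂ) :
    ‖(m (ξ - η) : ℂ)⁻¹ * z‖ₑ ≤ ‖(w η : ℂ) * (w ξ : ℂ)⁻¹ * z‖ₑ := by
  have h1 := hw.pos ξ
  have h2 := hw.pos η
  have h3 := hw.pos' (ξ - η)
  rw [enorm_le_iff_norm_le, norm_mul, norm_mul, norm_mul, norm_inv, norm_inv, Complex.norm_real,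
    Complex.norm_real, Complex.norm_real, Real.norm_of_nonneg h1.le, Real.norm_of_nonneg h2.le,
    Real.norm_of_nonneg h3.le]
  gcongr
  rw [← div_eq_mul_inv, le_div_iff₀ h1, inv_mul_le_iff₀ h3, mul_comm]
  exact hw.le_mul_sub ξ η

theorem measurable_weight_mul [MeasurableSpace E] [BorelSpace E] {a : E → ℂ}
    (ha : Measurable a) : Measurable fun ζ ↦ ‖(m ζ : ℂ) * a ζ‖ₑ := by
  have := hw.continuous'.measurable
  fun_prop

end IsModerate

variable [FiniteDimensional ℝ E] [MeasurableSpace E] [BorelSpace E]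

/-- If `h / w` is the Fourier transform of `u` and `a` the inverse Fourier transform of `ψ`, then
`symbolMul w a h / w` is the Fourier transform of `ψ u`. -/
def symbolMul (w : E → ℝ) (a h : E → ℂ) (η : E) : ℂ :=
  w η * ∫ ξ, h ξ * (w ξ : ℂ)⁻¹ * a (ξ - η)

theorem symbolMul_eq_integral (w : E → ℝ) (a h : E → ℂ) (η : E) :
    symbolMul w a h η = ∫ ξ, h ξ * ((w η : ℂ) * (w ξ : ℂ)⁻¹ * a (ξ - η)) := by
  rw [symbolMul, ← integral_const_mul]
  exact integral_congr_ae (.of_forall fun ξ ↦ by ring)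

variable {w m : E → ℝ} {a h : E → ℂ}

theorem measurable_symbolMul (hw : Continuous w) (ha : Measurable a) (hh : Measurable h) :
    Measurable (symbolMul w a h) := by
  have h1 : StronglyMeasurable fun η ↦ ∫ ξ, h ξ * (w ξ : ℂ)⁻¹ * a (ξ - η) := by
    refine StronglyMeasurable.integral_prod_right' (f := fun p : E × E ↦
      h p.2 * (w p.2 : ℂ)⁻¹ * a (p.2 - p.1)) (Measurable.stronglyMeasurable ?_)
    have := hw.measurable
    fun_prop
  have := hw.measurable
  exact (Complex.measurable_ofReal.comp this).mul h1.measurable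

namespace IsModerate

variable (hw : IsModerate w m)
include hw

theorem enorm_symbolMul_le (η : E) :
    ‖symbolMul w a h η‖ₑ ≤ ∫⁻ ξ, ‖h ξ‖ₑ * ‖(m (ξ - η) : ℂ) * a (ξ - η)‖ₑ := by
  rw [symbolMul_eq_integral]
  refine (enorm_integral_le_lintegral_enorm _).trans (lintegral_mono fun ξ ↦ ?_)
  rw [enorm_mul]
  gcongr
  exact hw.enorm_div_mul_le ξ η _

/-- Moderateness absorbs both weights of the kernel into `m(ξ - η)`, leaving a convolution with the
function `m a`, to which Young's inequality applies. -/
theorem eLpNorm_symbolMul_le (ha : Measurable a) (hh : Measurable h) :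
    eLpNorm (symbolMul w a h) 2 ≤ (∫⁻ ζ, ‖(m ζ : ℂ) * a ζ‖ₑ) * eLpNorm h 2 := by
  refine (ENNReal.pow_le_pow_left_iff two_ne_zero).1 ?_
  rw [mul_pow, eLpNorm_two_sq, eLpNorm_two_sq]
  refine le_trans (lintegral_mono fun η ↦ pow_le_pow_left' (hw.enorm_symbolMul_le η) 2) ?_
  exact lintegral_sq_lintegral_mul_sub_le hh.enorm (hw.measurable_weight_mul ha)

theorem lintegral_enorm_mul_le (ha : Measurable a) (hh : Measurable h) (η : E) :
    ∫⁻ ξ, ‖h ξ‖ₑ * ‖(m (ξ - η) : ℂ) * a (ξ - η)‖ₑ ≤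
      eLpNorm h 2 * (∫⁻ ζ, ‖(m ζ : ℂ) * a ζ‖ₑ ^ 2) ^ (1 / 2 : ℝ) := by
  have h0 := hw.measurable_weight_mul ha
  have h1 := lintegral_mul_sq_le volume (f := fun ξ ↦ ‖h ξ‖ₑ)
    (g := fun ξ ↦ ‖(m (ξ - η) : ℂ) * a (ξ - η)‖ₑ) hh.enorm.aemeasurable
    (h0.comp (measurable_id.sub_const η)).aemeasurable
  rw [lintegral_sub_right_eq_self (fun ζ ↦ ‖(m ζ : ℂ) * a ζ‖ₑ ^ 2) η, ← eLpNorm_two_sq] at h1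
  refine (ENNReal.pow_le_pow_left_iff two_ne_zero).1 (h1.trans_eq ?_)
  rw [mul_pow]
  congr 1
  rw [← ENNReal.rpow_natCast, ← ENNReal.rpow_mul]; norm_num

theorem integrable_symbolMul (ha : Measurable a) (hh : Measurable h) (hh2 : MemLp h 2)
    (ham : ∫⁻ ζ, ‖(m ζ : ℂ) * a ζ‖ₑ ^ 2 ≠ ⊤) (η : E) :
    Integrable fun ξ ↦ h ξ * (w ξ : ℂ)⁻¹ * a (ξ - η) := by
  have := hw.continuous.measurable
  have h2 : (w η : ℂ) ≠ 0 := Complex.ofReal_ne_zero.2 (hw.pos η).ne'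
  have h1 : Integrable fun ξ ↦ h ξ * ((w η : ℂ) * (w ξ : ℂ)⁻¹ * a (ξ - η)) := by
    refine ⟨Measurable.aestronglyMeasurable (by fun_prop), ?_⟩
    rw [hasFiniteIntegral_iff_enorm]
    refine lt_of_le_of_lt (lintegral_mono fun ξ ↦ ?_)
      ((hw.lintegral_enorm_mul_le ha hh η).trans_lt
      (ENNReal.mul_lt_top hh2.eLpNorm_lt_top
        (ENNReal.rpow_lt_top_of_nonneg (by norm_num) ham)))
    rw [enorm_mul]
    gcongr
    exact hw.enorm_div_mul_le ξ η _
  refine (h1.const_mul (w η : ℂ)⁻¹).congr (.of_forall fun ξ ↦ ?_)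
  dsimp only
  field_simp

/-- Fubini, with `b` standing for the inverse transform of a test function. After `w(η)⁻¹` is
shifted onto `b`, the integral over `ξ` is bounded uniformly in `η` by Cauchy–Schwarz, which gives
absolute convergence. -/
theorem integral_symbolMul (ha : Measurable a) (hh : Measurable h) (hh2 : MemLp h 2)
    (ham : ∫⁻ ζ, ‖(m ζ : ℂ) * a ζ‖ₑ ^ 2 ≠ ⊤) {b : E → ℂ} (hb : Measurable b)
    (hbw : ∫⁻ η, ‖(w η : ℂ)⁻¹ * b η‖ₑ ≠ ⊤) :
    ∫ ξ, h ξ * (w ξ : ℂ)⁻¹ * ∫ η, a (ξ - η) * b η =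
      ∫ η, symbolMul w a h η * (w η : ℂ)⁻¹ * b η := by
  have hwm := hw.continuous.measurable
  have hmm := hw.continuous'.measurable
  have hint : Integrable (Function.uncurry fun ξ η ↦ h ξ * (w ξ : ℂ)⁻¹ * (a (ξ - η) * b η))
      (volume.prod volume) := by
    have hm : Measurable (Function.uncurry fun ξ η ↦ h ξ * (w ξ : ℂ)⁻¹ * (a (ξ - η) * b η)) := by
      simp only [Function.uncurry_def]
      fun_prop
    refine ⟨hm.aestronglyMeasurable, ?_⟩
    rw [hasFiniteIntegral_iff_enorm, lintegral_prod_symm _ hm.enorm.aemeasurable]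
    calc ∫⁻ η, ∫⁻ ξ, ‖h ξ * (w ξ : ℂ)⁻¹ * (a (ξ - η) * b η)‖ₑ
        ≤ ∫⁻ η, ‖(w η : ℂ)⁻¹ * b η‖ₑ *
            ∫⁻ ξ, ‖h ξ‖ₑ * ‖(m (ξ - η) : ℂ) * a (ξ - η)‖ₑ := by
          refine lintegral_mono fun η ↦ ?_
          rw [← lintegral_const_mul _ (by fun_prop)]
          refine lintegral_mono fun ξ ↦ ?_
          have hη : (w η : ℂ) ≠ 0 := Complex.ofReal_ne_zero.2 (hw.pos η).ne'
          calc ‖h ξ * (w ξ : ℂ)⁻¹ * (a (ξ - η) * b η)‖ₑ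
              = ‖(w η : ℂ)⁻¹ * b η‖ₑ * (‖h ξ‖ₑ * ‖(w η : ℂ) * (w ξ : ℂ)⁻¹ * a (ξ - η)‖ₑ) := by
                rw [← enorm_mul, ← enorm_mul]
                congr 1
                field_simp
            _ ≤ _ := by
                gcongr
                exact hw.enorm_div_mul_le ξ η _
      _ ≤ ∫⁻ η, ‖(w η : ℂ)⁻¹ * b η‖ₑ *
            (eLpNorm h 2 * (∫⁻ ζ, ‖(m ζ : ℂ) * a ζ‖ₑ ^ 2) ^ (1 / 2 : ℝ)) := by
          refine lintegral_mono fun η ↦ ?_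
          gcongr
          exact hw.lintegral_enorm_mul_le ha hh η
      _ < ⊤ := by
          rw [lintegral_mul_const _ (by fun_prop)]
          exact ENNReal.mul_lt_top hbw.lt_top (ENNReal.mul_lt_top hh2.eLpNorm_lt_top
            (ENNReal.rpow_lt_top_of_nonneg (by norm_num) ham))
  simp_rw [← integral_const_mul]
  rw [integral_integral_swap hint]
  refine integral_congr_ae (.of_forall fun η ↦ ?_)
  have hη : (w η : ℂ) ≠ 0 := Complex.ofReal_ne_zero.2 (hw.pos η).ne'
  dsimp only
  have h1 : ∀ I : ℂ, (w η : ℂ) * I * (w η : ℂ)⁻¹ * b η = I * b η := fun I ↦ by field_simp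
  rw [symbolMul, h1, ← integral_mul_const]
  exact integral_congr_ae (.of_forall fun ξ ↦ by ring)

end IsModerate

/-! ### The square integral of the localizations -/

/-- The function `e^{2πi⟨y, ζ⟩} a(ζ)`, the inverse Fourier transform of a translate. -/
def modulate (y : E) (a : E → ℂ) (ζ : E) : ℂ :=
  Complex.exp (↑(2 * Real.pi * inner ℝ ζ y) * Complex.I) * a ζ

theorem symbolMul_modulate (w : E → ℝ) (a h : E → ℂ) (y η : E) :
    symbolMul w (modulate y a) h η =
      𝓕⁻ (fun ζ ↦ h (ζ + η) * ((w η : ℂ) * (w (ζ + η) : ℂ)⁻¹ * a ζ)) y := by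
  rw [symbolMul_eq_integral, Real.fourierInv_eq',
    ← integral_add_right_eq_self _ η]
  refine integral_congr_ae (.of_forall fun ζ ↦ ?_)
  simp only [add_sub_cancel_right, modulate, smul_eq_mul]
  ring

theorem measurable_symbolMul_modulate (hw : Continuous w) (ha : Measurable a)
    (hh : Measurable h) :
    Measurable fun p : E × E ↦ symbolMul w (modulate p.1 a) h p.2 := by
  have hwm := hw.measurable
  have h1 : StronglyMeasurable fun p : E × E ↦
      ∫ ξ, h ξ * (w ξ : ℂ)⁻¹ * modulate p.1 a (ξ - p.2) := by
    refine StronglyMeasurable.integral_prod_right' (f := fun p : (E × E) × E ↦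
      h p.2 * (w p.2 : ℂ)⁻¹ * modulate p.1.1 a (p.2 - p.1.2)) (Measurable.stronglyMeasurable ?_)
    unfold modulate
    fun_prop
  unfold symbolMul
  exact (Complex.measurable_ofReal.comp (hwm.comp measurable_snd)).mul h1.measurable

namespace IsModerate

variable (hw : IsModerate w m)
include hw

/-- Plancherel in `y` for fixed `η`, between two applications of Tonelli. This exact formula carries
both halves of the norm equivalence. -/
theorem lintegral_symbolMul_modulate (ha : Measurable a) (hh : Measurable h) (hh2 : MemLp h 2)
    (ham : ∫⁻ ζ, ‖(m ζ : ℂ) * a ζ‖ₑ ^ 2 ≠ ⊤) :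
    ∫⁻ y, eLpNorm (symbolMul w (modulate y a) h) 2 ^ 2 =
      ∫⁻ ξ, ‖h ξ‖ₑ ^ 2 * ∫⁻ η, ‖(w η : ℂ) * (w ξ : ℂ)⁻¹ * a (ξ - η)‖ₑ ^ 2 := by
  have hwm := hw.continuous.measurable
  have hmm := hw.continuous'.measurable
  have hmeas : Measurable fun p : E × E ↦
      ‖h p.2 * ((w p.1 : ℂ) * (w p.2 : ℂ)⁻¹ * a (p.2 - p.1))‖ₑ ^ 2 := by fun_prop
  have hbound : ∀ ξ, ∫⁻ η, ‖(w η : ℂ) * (w ξ : ℂ)⁻¹ * a (ξ - η)‖ₑ ^ 2 ≤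
      ∫⁻ ζ, ‖(m ζ : ℂ) * a ζ‖ₑ ^ 2 := fun ξ ↦ by
    rw [← lintegral_sub_left_eq_self (fun ζ ↦ ‖(m ζ : ℂ) * a ζ‖ₑ ^ 2) ξ]
    exact lintegral_mono fun η ↦ pow_le_pow_left' (hw.enorm_div_mul_le ξ η _) 2
  have hswap : ∫⁻ η, ∫⁻ ξ, ‖h ξ * ((w η : ℂ) * (w ξ : ℂ)⁻¹ * a (ξ - η))‖ₑ ^ 2 =
      ∫⁻ ξ, ‖h ξ‖ₑ ^ 2 * ∫⁻ η, ‖(w η : ℂ) * (w ξ : ℂ)⁻¹ * a (ξ - η)‖ₑ ^ 2 := by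
    rw [lintegral_lintegral_swap hmeas.aemeasurable]
    refine lintegral_congr fun ξ ↦ ?_
    rw [← lintegral_const_mul _ (by fun_prop)]
    simp_rw [enorm_mul (h ξ), mul_pow]
  have hfin : ∫⁻ η, ∫⁻ ξ, ‖h ξ * ((w η : ℂ) * (w ξ : ℂ)⁻¹ * a (ξ - η))‖ₑ ^ 2 ≠ ⊤ := by
    rw [hswap]
    refine ne_top_of_le_ne_top ?_ (lintegral_mono fun ξ ↦ mul_le_mul_right (hbound ξ) _)
    rw [lintegral_mul_const _ (by fun_prop), ← eLpNorm_two_sq]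
    exact ENNReal.mul_ne_top (ENNReal.pow_ne_top hh2.eLpNorm_ne_top) ham
  simp_rw [eLpNorm_two_sq]
  rw [lintegral_lintegral_swap
    ((measurable_symbolMul_modulate hw.continuous ha hh).enorm.pow_const 2).aemeasurable, ← hswap]
  refine lintegral_congr_ae ?_
  -- Integrability holds for every `η`, but square integrability, also needed for Plancherel, comes
  -- from the finite double integral and so only for almost every `η`.
  filter_upwards [ae_lt_top (Measurable.lintegral_prod_right' hmeas) hfin] with η hη
  have h1 := (hw.integrable_symbolMul ha hh hh2 ham η).const_mul (w η : ℂ)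
  have h2 : Integrable fun ζ ↦ h (ζ + η) * ((w η : ℂ) * (w (ζ + η) : ℂ)⁻¹ * a ζ) := by
    refine (h1.comp_add_right η).congr (.of_forall fun ζ ↦ ?_)
    simp only [add_sub_cancel_right]
    ring
  have h3 : ∫⁻ ζ, ‖h (ζ + η) * ((w η : ℂ) * (w (ζ + η) : ℂ)⁻¹ * a ζ)‖ₑ ^ 2 =
      ∫⁻ ξ, ‖h ξ * ((w η : ℂ) * (w ξ : ℂ)⁻¹ * a (ξ - η))‖ₑ ^ 2 := by
    rw [← lintegral_add_right_eq_self
      (fun ξ ↦ ‖h ξ * ((w η : ℂ) * (w ξ : ℂ)⁻¹ * a (ξ - η))‖ₑ ^ 2) η]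
    simp only [add_sub_cancel_right]
  have h4 : MemLp (fun ζ ↦ h (ζ + η) * ((w η : ℂ) * (w (ζ + η) : ℂ)⁻¹ * a ζ)) 2 := by
    refine ⟨h2.aestronglyMeasurable, ?_⟩
    have h5 : eLpNorm (fun ζ ↦ h (ζ + η) * ((w η : ℂ) * (w (ζ + η) : ℂ)⁻¹ * a ζ)) 2 ^ 2 < ⊤ := by
      rw [eLpNorm_two_sq, h3]; exact hη
    simpa using h5
  simp_rw [symbolMul_modulate]
  rw [lintegral_enorm_fourierInv_sq h2 h4, h3]

theorem lintegral_symbolMul_modulate_le (ha : Measurable a) (hh : Measurable h) (hh2 : MemLp h 2)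
    (ham : ∫⁻ ζ, ‖(m ζ : ℂ) * a ζ‖ₑ ^ 2 ≠ ⊤) :
    ∫⁻ y, eLpNorm (symbolMul w (modulate y a) h) 2 ^ 2 ≤
      (∫⁻ ζ, ‖(m ζ : ℂ) * a ζ‖ₑ ^ 2) * eLpNorm h 2 ^ 2 := by
  rw [hw.lintegral_symbolMul_modulate ha hh hh2 ham, eLpNorm_two_sq,
    ← lintegral_const_mul _ (by fun_prop)]
  refine lintegral_mono fun ξ ↦ ?_
  rw [mul_comm, ← lintegral_sub_left_eq_self (fun ζ ↦ ‖(m ζ : ℂ) * a ζ‖ₑ ^ 2) ξ]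
  gcongr with η
  exact hw.enorm_div_mul_le ξ η _

theorem le_lintegral_symbolMul_modulate (ha : Measurable a) (hh : Measurable h) (hh2 : MemLp h 2)
    (ham : ∫⁻ ζ, ‖(m ζ : ℂ) * a ζ‖ₑ ^ 2 ≠ ⊤) :
    (∫⁻ ζ, ‖(m ζ : ℂ)⁻¹ * a ζ‖ₑ ^ 2) * eLpNorm h 2 ^ 2 ≤
      ∫⁻ y, eLpNorm (symbolMul w (modulate y a) h) 2 ^ 2 := by
  rw [hw.lintegral_symbolMul_modulate ha hh hh2 ham, eLpNorm_two_sq,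
    ← lintegral_const_mul _ (by fun_prop)]
  refine lintegral_mono fun ξ ↦ ?_
  rw [mul_comm, ← lintegral_sub_left_eq_self (fun ζ ↦ ‖(m ζ : ℂ)⁻¹ * a ζ‖ₑ ^ 2) ξ]
  gcongr with η
  exact hw.enorm_inv_mul_le ξ η _

end IsModerate

end Weights

/-! ### The weights `⟨⟨2πξ⟩⟩^s` -/

section Peetre

variable {E : Type*} [SeminormedAddCommGroup E]

theorem one_add_norm_add_sq_le (x y : E) :
    1 + ‖x + y‖ ^ 2 ≤ 2 * (1 + ‖y‖ ^ 2) * (1 + ‖x‖ ^ 2) := by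
  have h := pow_le_pow_left₀ (norm_nonneg _) (norm_add_le x y) 2
  nlinarith [sq_nonneg (‖x‖ - ‖y‖), mul_nonneg (sq_nonneg ‖x‖) (sq_nonneg ‖y‖)]

/-- Peetre's inequality. -/
theorem one_add_norm_add_sq_rpow_le (x y : E) (t : ℝ) :
    (1 + ‖x + y‖ ^ 2) ^ t ≤ (1 + ‖x‖ ^ 2) ^ t * (2 ^ |t| * (1 + ‖y‖ ^ 2) ^ |t|) := by
  have hx : 0 < 1 + ‖x‖ ^ 2 := by positivity
  have hy : 0 < 2 * (1 + ‖y‖ ^ 2) := by positivity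
  have hxy : 0 < 1 + ‖x + y‖ ^ 2 := by positivity
  rw [← Real.mul_rpow two_pos.le (by positivity), mul_comm]
  rcases le_total 0 t with ht | ht
  · rw [abs_of_nonneg ht, ← Real.mul_rpow hy.le hx.le]
    exact Real.rpow_le_rpow hxy.le (one_add_norm_add_sq_le x y) ht
  -- For `t ≤ 0` the base inequality is used for `x = (x + y) + (-y)`, and the negative power
  -- reverses it.
  · rw [abs_of_nonpos ht, Real.rpow_neg hy.le, ← Real.inv_rpow hy.le,
      ← Real.mul_rpow (by positivity) hx.le]
    refine Real.rpow_le_rpow_of_nonpos (by positivity) ?_ ht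
    rw [inv_mul_le_iff₀ hy]
    simpa using one_add_norm_add_sq_le (x + y) (-y)

end Peetre

section Bessel

variable {n : ℕ}

theorem blockPart_add (c : Composition n) (l : Fin c.length) (x y : EuclideanSpace ℝ (Fin n)) :
    blockPart c l (x + y) = blockPart c l x + blockPart c l y := rfl

theorem blockPart_smul (c : Composition n) (l : Fin c.length) (r : ℝ)
    (x : EuclideanSpace ℝ (Fin n)) : blockPart c l (r • x) = r • blockPart c l x := rfl

/-- The weight `⟨⟨2πξ⟩⟩^s`. -/
def weight (c : Composition n) (s : Fin c.length → ℝ) (ξ : EuclideanSpace ℝ (Fin n)) : ℝ :=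
  multiBracket c s ((2 * Real.pi) • ξ)

/-- A weight with respect to which `weight c s` is moderate. -/
def moderator (c : Composition n) (s : Fin c.length → ℝ) (ξ : EuclideanSpace ℝ (Fin n)) : ℝ :=
  (∏ l, 2 ^ |s l / 2|) * weight c (fun l ↦ |s l|) ξ

theorem weight_pos (c : Composition n) (s : Fin c.length → ℝ) (ξ : EuclideanSpace ℝ (Fin n)) :
    0 < weight c s ξ := by
  unfold weight multiBracket
  exact Finset.prod_pos fun _ _ ↦ by positivity

theorem weight_neg (c : Composition n) (s : Fin c.length → ℝ) (ξ : EuclideanSpace ℝ (Fin n)) :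
    weight c (-s) ξ = (weight c s ξ)⁻¹ := by
  rw [weight, weight, multiBracket, multiBracket, ← Finset.prod_inv_distrib]
  refine Finset.prod_congr rfl fun l _ ↦ ?_
  rw [Pi.neg_apply, neg_div, Real.rpow_neg (by positivity)]

/-- Peetre's inequality block by block with exponent `s_l / 2`. The inverse weight is the weight of
order `-s`, hence also of temperate growth. -/
theorem isModerate_weight (c : Composition n) (s : Fin c.length → ℝ) :
    IsModerate (weight c s) (moderator c s) where
  pos := weight_pos c s
  pos' ξ := mul_pos (Finset.prod_pos fun _ _ ↦ by positivity) (weight_pos c _ ξ)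
  growth := multiBracket_hasTemperateGrowth c s
  growth_inv := by
    simp_rw [← Complex.ofReal_inv, ← weight_neg]
    exact multiBracket_hasTemperateGrowth c (-s)
  growth' := by
    simp only [moderator, Complex.ofReal_mul]
    exact (Function.HasTemperateGrowth.const _).mul (multiBracket_hasTemperateGrowth c _)
  even ξ := by
    simp only [moderator, weight, multiBracket, smul_neg]
    congr 2
    ext l
    rw [← neg_one_smul ℝ, blockPart_smul, neg_one_smul, norm_neg]
  le_smul R ξ hR := by
    unfold moderator weight multiBracket
    gcongr with l _
    rw [smul_comm, blockPart_smul c l R, norm_smul, Real.norm_of_nonneg (by positivity)]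
    exact le_mul_of_one_le_left (norm_nonneg _) hR
  add_le ξ η := by
    unfold moderator weight multiBracket
    rw [← Finset.prod_mul_distrib, ← Finset.prod_mul_distrib, smul_add]
    refine Finset.prod_le_prod (fun _ _ ↦ by positivity) fun l _ ↦ ?_
    have h := one_add_norm_add_sq_rpow_le (blockPart c l ((2 * Real.pi) • ξ))
      (blockPart c l ((2 * Real.pi) • η)) (s l / 2)
    rw [blockPart_add]
    rwa [abs_div, abs_two] at h ⊢

end Bessel

/-! ### Symbols of distributions -/

section Symbol

variable {E : Type*} [NormedAddCommGroup E] [InnerProductSpace ℝ E] [FiniteDimensional ℝ E]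
  [MeasurableSpace E] [BorelSpace E]

/-- The function `h / w` is the Fourier transform of `u`. -/
def IsSymbol (w : E → ℝ) (u : 𝓓'((⊤ : Opens E), ℂ)) (h : E → ℂ) : Prop :=
  ∀ φ : 𝓓((⊤ : Opens E), ℝ), u φ = ∫ ξ, h ξ * (w ξ : ℂ)⁻¹ * 𝓕⁻ (testToSchwartz φ) ξ

theorem IsSymbol.congr {w : E → ℝ} {u : 𝓓'((⊤ : Opens E), ℂ)} {h h' : E → ℂ}
    (hu : IsSymbol w u h) (hh : h =ᵐ[volume] h') : IsSymbol w u h' := fun φ ↦ by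
  rw [hu φ]
  refine integral_congr_ae ?_
  filter_upwards [hh] with ξ hξ
  rw [hξ]

end Symbol

/-! ### Symbols and the operators `⟨⟨D⟩⟩^s` -/

section Bessel

variable {n : ℕ} (c : Composition n) (s : Fin c.length → ℝ)

theorem multiBessel_multiBessel (s t : Fin c.length → ℝ) (hst : s + t = 0)
    (v : 𝓢'(EuclideanSpace ℝ (Fin n), ℂ)) : multiBessel c s (multiBessel c t v) = v := by
  rw [multiBessel, multiBessel,
    TemperedDistribution.fourierMultiplierCLM_fourierMultiplierCLM_apply
    (multiBracket_hasTemperateGrowth c t) (multiBracket_hasTemperateGrowth c s)]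
  have h : ((fun ξ : EuclideanSpace ℝ (Fin n) ↦ (weight c t ξ : ℂ)) *
      fun ξ ↦ (weight c s ξ : ℂ)) = fun _ ↦ 1 := by
    ext ξ
    rw [eq_neg_of_add_eq_zero_right hst, Pi.mul_apply, weight_neg, ← Complex.ofReal_mul,
      inv_mul_cancel₀ (weight_pos c s ξ).ne', Complex.ofReal_one]
  simp only [weight] at h
  rw [h, TemperedDistribution.fourierMultiplierCLM_const, one_smul,
    ContinuousLinearMap.id_apply]

theorem multiBessel_neg_lp_apply (f : Lp ℂ 2 (volume : Measure (EuclideanSpace ℝ (Fin n))))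
    (g : 𝓢(EuclideanSpace ℝ (Fin n), ℂ)) :
    multiBessel c (-s) f g = ∫ ξ, (𝓕 f : Lp ℂ 2 _) ξ * (weight c s ξ : ℂ)⁻¹ * 𝓕⁻ g ξ := by
  rw [multiBessel, TemperedDistribution.fourierMultiplierCLM_apply_apply,
    ← TemperedDistribution.fourier_apply, Lp.fourier_toTemperedDistribution_eq,
    Lp.toTemperedDistribution_apply]
  refine integral_congr_ae (.of_forall fun ξ ↦ ?_)
  dsimp only
  rw [SchwartzMap.smulLeftCLM_apply_apply (multiBracket_hasTemperateGrowth c (-s)), ← weight,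
    weight_neg, Complex.ofReal_inv]
  simp only [smul_eq_mul]
  ring

/-- Since `⟨⟨D⟩⟩^s` is inverted by `⟨⟨D⟩⟩^{-s}`, the tempered extension of `u` can only be
`⟨⟨D⟩⟩^{-s} f`, whose pairing with a test function is the symbol integral. -/
theorem hasBessel_iff (u : 𝓓'((⊤ : Opens (EuclideanSpace ℝ (Fin n))), ℂ))
    (f : Lp ℂ 2 (volume : Measure (EuclideanSpace ℝ (Fin n)))) :
    HasBessel c s u f ↔ IsSymbol (weight c s) u (𝓕 f : Lp ℂ 2 _) := by
  constructor
  · rintro ⟨v, hv, hvf⟩ φ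
    rw [hv φ, ← multiBessel_neg_lp_apply, ← hvf, multiBessel_multiBessel c _ _ (neg_add_cancel s)]
  · intro h
    refine ⟨multiBessel c (-s) f, fun φ ↦ ?_, multiBessel_multiBessel c _ _ (add_neg_cancel s) _⟩
    rw [h φ, multiBessel_neg_lp_apply]

theorem mem_sobolevSpace_iff_exists_isSymbol
    (u : 𝓓'((⊤ : Opens (EuclideanSpace ℝ (Fin n))), ℂ)) :
    u ∈ sobolevSpace c s ↔ ∃ h : EuclideanSpace ℝ (Fin n) → ℂ,
      Measurable h ∧ MemLp h 2 ∧ IsSymbol (weight c s) u h := by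
  constructor
  · rintro ⟨f, hf⟩
    exact ⟨_, (Lp.stronglyMeasurable _).measurable, Lp.memLp _, (hasBessel_iff c s u f).1 hf⟩
  · rintro ⟨h, -, h2, hu⟩
    refine ⟨𝓕⁻ (h2.toLp h), (hasBessel_iff c s u _).2 ?_⟩
    rw [fourier_fourierInv_eq]
    exact hu.congr h2.coeFn_toLp.symm

end Bessel

/-! ### Complex test functions -/

section TestFunctions

variable {E : Type*} [NormedAddCommGroup E] [NormedSpace ℝ E]

/-- A complex test function regarded as a Schwartz function. -/
def toSchwartz (φ : 𝓓((⊤ : Opens E), ℂ)) : 𝓢(E, ℂ) :=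
  φ.hasCompactSupport.toSchwartzMap φ.contDiff

theorem toSchwartz_apply (φ : 𝓓((⊤ : Opens E), ℂ)) (x : E) : toSchwartz φ x = φ x := rfl

theorem testToSchwartz_apply (φ : 𝓓((⊤ : Opens E), ℝ)) (x : E) : testToSchwartz φ x = φ x := rfl

theorem testMul_apply {Ω : Opens E} (ψ : E → ℂ) (hψ : ContDiff ℝ ∞ ψ) (φ : 𝓓(Ω, ℝ)) (x : E) :
    testMul ψ hψ φ x = φ x * ψ x := rfl

theorem complexify_apply {Ω : Opens E} (u : 𝓓'(Ω, ℂ)) (φ : 𝓓(Ω, ℂ)) :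
    complexify u φ = u (TestFunction.postcompCLM Complex.reCLM φ) +
      Complex.I * u (TestFunction.postcompCLM Complex.imCLM φ) := rfl

theorem smoothMul_eq_complexify {Ω : Opens E} (ψ : E → ℂ) (hψ : ContDiff ℝ ∞ ψ) (u : 𝓓'(Ω, ℂ))
    (φ : 𝓓(Ω, ℝ)) : smoothMul ψ hψ u φ = complexify u (testMul ψ hψ φ) := rfl

/-- `complexify` is built as a real-linear map; its complex linearity is what makes iterated
products associative in `smoothMul_smoothMul`. -/
theorem complexify_I_smul {Ω : Opens E} (u : 𝓓'(Ω, ℂ)) (φ : 𝓓(Ω, ℂ)) :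
    complexify u (Complex.I • φ) = Complex.I * complexify u φ := by
  have h1 : TestFunction.postcompCLM Complex.reCLM (Complex.I • φ) =
      -TestFunction.postcompCLM Complex.imCLM φ := by
    ext x; simp
  have h2 : TestFunction.postcompCLM Complex.imCLM (Complex.I • φ) =
      TestFunction.postcompCLM Complex.reCLM φ := by
    ext x; simp
  rw [complexify_apply, complexify_apply, h1, h2, map_neg]
  linear_combination -u (TestFunction.postcompCLM Complex.imCLM φ) * Complex.I_sq

theorem toSchwartz_eq (φ : 𝓓((⊤ : Opens E), ℂ)) :
    toSchwartz φ = testToSchwartz (TestFunction.postcompCLM Complex.reCLM φ) +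
      Complex.I • testToSchwartz (TestFunction.postcompCLM Complex.imCLM φ) := by
  ext x
  simp only [add_apply, smul_apply, testToSchwartz_apply,
    toSchwartz_apply, TestFunction.postcompCLM_apply]
  simp [mul_comm Complex.I]

/-- The product of two test functions. -/
def testProd (ψ χ : 𝓓((⊤ : Opens E), ℂ)) : 𝓓((⊤ : Opens E), ℂ) where
  toFun x := ψ x * χ x
  contDiff' := ψ.contDiff.mul χ.contDiff
  hasCompactSupport' := ψ.hasCompactSupport.mul_right
  tsupport_subset' := Set.subset_univ _

theorem smoothMul_smoothMul (ψ χ : 𝓓((⊤ : Opens E), ℂ)) (u : 𝓓'((⊤ : Opens E), ℂ)) :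
    smoothMul ψ ψ.contDiff (smoothMul χ χ.contDiff u) =
      smoothMul (testProd ψ χ) (testProd ψ χ).contDiff u := by
  ext φ
  rw [smoothMul_eq_complexify, complexify_apply, smoothMul_eq_complexify, smoothMul_eq_complexify,
    smoothMul_eq_complexify, ← complexify_I_smul, ← map_add]
  congr 1
  ext x
  simp only [add_apply, smul_apply, testMul_apply, TestFunction.postcompCLM_apply]
  have h : testProd ψ χ x = ψ x * χ x := rfl
  have h2 := Complex.re_add_im (φ x * ψ x)
  simp only [Function.comp_apply, testMul_apply, smul_eq_mul, Complex.reCLM_apply,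
    Complex.imCLM_apply, h]
  linear_combination χ x * h2

theorem smoothMul_comm (ψ χ : 𝓓((⊤ : Opens E), ℂ)) (u : 𝓓'((⊤ : Opens E), ℂ)) :
    smoothMul ψ ψ.contDiff (smoothMul χ χ.contDiff u) =
      smoothMul χ χ.contDiff (smoothMul ψ ψ.contDiff u) := by
  rw [smoothMul_smoothMul, smoothMul_smoothMul]
  congr 1
  ext x
  exact mul_comm _ _

theorem smoothMul_apply_eq_sum {ι : Type*} (t : Finset ι) (ψ : 𝓓((⊤ : Opens E), ℂ))
    (χ : ι → 𝓓((⊤ : Opens E), ℂ)) (h : ∀ x, ψ x = ∑ i ∈ t, χ i x)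
    (u : 𝓓'((⊤ : Opens E), ℂ)) (φ : 𝓓((⊤ : Opens E), ℝ)) :
    smoothMul ψ ψ.contDiff u φ = ∑ i ∈ t, smoothMul (χ i) (χ i).contDiff u φ := by
  simp only [smoothMul_eq_complexify]
  rw [← map_sum]
  congr 1
  ext x
  simp [testMul_apply, h, Finset.mul_sum]

theorem exists_testFunction_ne_zero [FiniteDimensional ℝ E] :
    ∃ χ : 𝓓((⊤ : Opens E), ℂ), χ ≠ 0 := by
  obtain ⟨f, -, hfc, hf, -, hf0⟩ := exists_contDiff_tsupport_subset (n := ⊤) (x := (0 : E))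
    Filter.univ_mem
  refine ⟨⟨fun x ↦ (f x : ℂ), Complex.ofRealCLM.contDiff.comp hf,
    hfc.comp_left Complex.ofReal_zero, Set.subset_univ _⟩, fun h ↦ ?_⟩
  have h1 : (f 0 : ℂ) = 0 := DFunLike.congr_fun h 0
  rw [hf0] at h1
  simp at h1

end TestFunctions

/-! ### Symbols of products with test functions; uniqueness of symbols -/

section Symbol

variable {E : Type*} [NormedAddCommGroup E] [InnerProductSpace ℝ E] [FiniteDimensional ℝ E]
  [MeasurableSpace E] [BorelSpace E]

theorem memLp_growth_mul {g : E → ℂ} (hg : g.HasTemperateGrowth) (a : 𝓢(E, ℂ)) (p : ℝ≥0∞) :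
    MemLp (fun ξ ↦ g ξ * a ξ) p := by
  refine ((SchwartzMap.smulLeftCLM ℂ g a).memLp p).ae_eq (.of_forall fun ξ ↦ ?_)
  rw [SchwartzMap.smulLeftCLM_apply_apply hg, smul_eq_mul]

theorem lintegral_growth_mul_ne_top {g : E → ℂ} (hg : g.HasTemperateGrowth) (a : 𝓢(E, ℂ)) :
    ∫⁻ ξ, ‖g ξ * a ξ‖ₑ ≠ ⊤ := by
  rw [← eLpNorm_one_eq_lintegral_enorm]
  exact (memLp_growth_mul hg a 1).eLpNorm_ne_top

theorem lintegral_growth_mul_sq_ne_top {g : E → ℂ} (hg : g.HasTemperateGrowth) (a : 𝓢(E, ℂ)) :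
    ∫⁻ ξ, ‖g ξ * a ξ‖ₑ ^ 2 ≠ ⊤ := by
  rw [← eLpNorm_two_sq]
  exact ENNReal.pow_ne_top (memLp_growth_mul hg a 2).eLpNorm_ne_top

theorem fourierInv_mul_apply (f g k : 𝓢(E, ℂ)) (hk : ∀ x, k x = f x * g x) (ξ : E) :
    𝓕⁻ k ξ = ∫ η, 𝓕⁻ f (ξ - η) * 𝓕⁻ g η := by
  have h1 : k = 𝓕 (SchwartzMap.convolution (ContinuousLinearMap.mul ℂ ℂ) (𝓕⁻ g) (𝓕⁻ f)) := by
    rw [SchwartzMap.fourier_convolution]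
    ext x
    simp [hk, mul_comm]
  rw [h1, fourierInv_fourier_eq, SchwartzMap.convolution_apply, convolution]
  refine integral_congr_ae (.of_forall fun η ↦ ?_)
  exact mul_comm _ _

/-- The inverse Fourier transform of a complex test function. -/
def invTransform (φ : 𝓓((⊤ : Opens E), ℂ)) : 𝓢(E, ℂ) :=
  𝓕⁻ (toSchwartz φ)

variable {w m : E → ℝ} {h : E → ℂ} {u : 𝓓'((⊤ : Opens E), ℂ)}

namespace IsModerate

variable (hw : IsModerate w m)
include hw

theorem integrable_symbol_mul (hh : MemLp h 2) (a : 𝓢(E, ℂ)) :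
    Integrable fun ξ ↦ h ξ * (w ξ : ℂ)⁻¹ * a ξ := by
  refine (MemLp.integrable_mul hh (memLp_growth_mul hw.growth_inv a 2)).congr
    (.of_forall fun ξ ↦ ?_)
  simp only [Pi.mul_apply, mul_assoc]

theorem isSymbol_sum {ι : Type*} (t : Finset ι) {k : ι → E → ℂ} (hk : ∀ i ∈ t, MemLp (k i) 2)
    {v : ι → 𝓓'((⊤ : Opens E), ℂ)} (hv : ∀ i ∈ t, IsSymbol w (v i) (k i))
    (hu : ∀ φ, u φ = ∑ i ∈ t, v i φ) : IsSymbol w u (∑ i ∈ t, k i) := fun φ ↦ by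
  rw [hu, Finset.sum_congr rfl fun i hi ↦ hv i hi φ,
    ← integral_finsetSum _ fun i hi ↦ hw.integrable_symbol_mul (hk i hi) _]
  refine integral_congr_ae (.of_forall fun ξ ↦ ?_)
  simp only [Finset.sum_apply, Finset.sum_mul]

theorem isSymbol_zero_sub {h' : E → ℂ} (hh : MemLp h 2) (hh' : MemLp h' 2) (hu : IsSymbol w u h)
    (hu' : IsSymbol w u h') : IsSymbol w 0 (h - h') := fun φ ↦ by
  have h1 := integral_sub (hw.integrable_symbol_mul hh (𝓕⁻ (testToSchwartz φ)))
    (hw.integrable_symbol_mul hh' (𝓕⁻ (testToSchwartz φ)))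
  rw [← hu φ, ← hu' φ, sub_self] at h1
  refine h1.symm.trans (integral_congr_ae (.of_forall fun ξ ↦ ?_))
  simp only [Pi.sub_apply, sub_mul]

theorem complexify_eq (hh : MemLp h 2) (hu : IsSymbol w u h) (φ : 𝓓((⊤ : Opens E), ℂ)) :
    complexify u φ = ∫ ξ, h ξ * (w ξ : ℂ)⁻¹ * invTransform φ ξ := by
  rw [complexify_apply, hu, hu, invTransform, toSchwartz_eq, ← integral_const_mul, ← integral_add
    (hw.integrable_symbol_mul hh _) ((hw.integrable_symbol_mul hh _).const_mul _),
    FourierTransform.fourierInv_add, FourierTransform.fourierInv_smul]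
  refine integral_congr_ae (.of_forall fun ξ ↦ ?_)
  simp only [add_apply, smul_apply, smul_eq_mul]
  ring

/-- The inverse transform of `ψ φ` is a convolution; `integral_symbolMul` moves the factor coming
from `ψ` over to `h`. -/
theorem isSymbol_smoothMul (hm : Measurable h) (hh : MemLp h 2) (hu : IsSymbol w u h)
    (ψ : 𝓓((⊤ : Opens E), ℂ)) :
    IsSymbol w (smoothMul ψ ψ.contDiff u) (symbolMul w (invTransform ψ) h) := fun φ ↦ by
  rw [smoothMul_eq_complexify, hw.complexify_eq hh hu,
    ← hw.integral_symbolMul (invTransform ψ).continuous.measurable hm hh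
      (lintegral_growth_mul_sq_ne_top hw.growth' _)
      (𝓕⁻ (testToSchwartz φ)).continuous.measurable
      (lintegral_growth_mul_ne_top hw.growth_inv _)]
  refine integral_congr_ae (.of_forall fun ξ ↦ ?_)
  dsimp only
  rw [invTransform, invTransform, fourierInv_mul_apply (toSchwartz ψ) (testToSchwartz φ)]
  intro x
  rw [toSchwartz_apply, testMul_apply, toSchwartz_apply, testToSchwartz_apply, mul_comm]

theorem memLp_symbolMul {a : E → ℂ} (ha : Measurable a) (ham : ∫⁻ ζ, ‖(m ζ : ℂ) * a ζ‖ₑ ≠ ⊤)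
    (hm : Measurable h) (hh : MemLp h 2) : MemLp (symbolMul w a h) 2 :=
  ⟨(measurable_symbolMul hw.continuous ha hm).aestronglyMeasurable,
    (hw.eLpNorm_symbolMul_le ha hm).trans_lt (ENNReal.mul_lt_top ham.lt_top hh.eLpNorm_lt_top)⟩

end IsModerate

theorem fourierInv_translate (y : E) (χ : 𝓓((⊤ : Opens E), ℂ)) :
    ⇑(invTransform (translate y χ)) = modulate y (invTransform χ) := by
  ext ζ
  rw [modulate, invTransform, invTransform, SchwartzMap.fourierInv_coe, SchwartzMap.fourierInv_coe, Real.fourierInv_eq',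
    Real.fourierInv_eq', ← integral_const_mul, ← integral_add_right_eq_self _ y]
  refine integral_congr_ae (.of_forall fun x ↦ ?_)
  have h1 : toSchwartz (translate y χ) (x + y) = toSchwartz χ x := by
    change χ (x + y - y) = χ x
    rw [add_sub_cancel_right]
  dsimp only
  rw [h1, smul_eq_mul, smul_eq_mul, ← mul_assoc, ← Complex.exp_add, inner_add_left,
    real_inner_comm y ζ]
  congr 2
  push_cast
  ring

/-- A test function multiplied by the character `e^{-2πi⟨x, η⟩}`. -/
def testModulate (η : E) (χ : 𝓓((⊤ : Opens E), ℂ)) : 𝓓((⊤ : Opens E), ℂ) where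
  toFun x := Complex.exp (↑(-(2 * Real.pi * inner ℝ x η)) * Complex.I) * χ x
  contDiff' := by
    have := χ.contDiff
    have h1 : ContDiff ℝ ∞ fun x : E ↦ -(2 * Real.pi * inner ℝ x η) :=
      (contDiff_const.mul (contDiff_id.inner ℝ contDiff_const)).neg
    exact (((Complex.ofRealCLM.contDiff.comp h1).mul contDiff_const).cexp).mul this
  hasCompactSupport' := χ.hasCompactSupport.mul_left
  tsupport_subset' := Set.subset_univ _

theorem fourierInv_testModulate (η : E) (χ : 𝓓((⊤ : Opens E), ℂ)) (ξ : E) :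
    invTransform (testModulate η χ) ξ = invTransform χ (ξ - η) := by
  rw [invTransform, invTransform, SchwartzMap.fourierInv_coe, SchwartzMap.fourierInv_coe, Real.fourierInv_eq',
    Real.fourierInv_eq']
  refine integral_congr_ae (.of_forall fun x ↦ ?_)
  change _ * (Complex.exp (↑(-(2 * Real.pi * inner ℝ x η)) * Complex.I) * χ x) = _ * χ x
  rw [← mul_assoc, ← Complex.exp_add, inner_sub_right]
  congr 2
  push_cast
  ring

namespace IsModerate

variable (hw : IsModerate w m)
include hw

/-- The right-hand side involves `u` but not `h`, so any square-integrable symbol of `0` has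
vanishing localizations. This feeds `isSymbol_unique`. -/
theorem symbolMul_eq_complexify (hh : MemLp h 2) (hu : IsSymbol w u h)
    (ψ : 𝓓((⊤ : Opens E), ℂ)) (η : E) :
    symbolMul w (invTransform ψ) h η = w η * complexify u (testModulate η ψ) := by
  rw [hw.complexify_eq hh hu, symbolMul]
  simp_rw [fourierInv_testModulate]

theorem lintegral_inv_mul_sq_ne_zero {χ : 𝓓((⊤ : Opens E), ℂ)} (hχ : χ ≠ 0) :
    ∫⁻ ζ, ‖(m ζ : ℂ)⁻¹ * invTransform χ ζ‖ₑ ^ 2 ≠ 0 := by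
  intro h0
  have hc : Continuous fun ζ ↦ (m ζ : ℂ)⁻¹ * invTransform χ ζ :=
    ((Complex.continuous_ofReal.comp hw.continuous').inv₀
      fun ζ ↦ Complex.ofReal_ne_zero.2 (hw.pos' ζ).ne').mul (invTransform χ).continuous
  have h1 := (lintegral_eq_zero_iff (hc.measurable.enorm.pow_const 2)).1 h0
  have h2 : (fun ζ ↦ (m ζ : ℂ)⁻¹ * invTransform χ ζ) = fun _ ↦ 0 := by
    refine (hc.ae_eq_iff_eq volume continuous_const).1 ?_
    filter_upwards [h1] with ζ hζ
    simpa using hζ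
  have h3 : 𝓕⁻ (toSchwartz χ) = 0 := by
    ext ζ
    have := congrFun h2 ζ
    simpa [invTransform, (hw.pos' ζ).ne'] using this
  have h4 : toSchwartz χ = 0 := by
    rw [← fourier_fourierInv_eq (F := 𝓢(E, ℂ)) (toSchwartz χ), h3]
    exact FourierTransform.fourier_zero
  exact hχ (TestFunction.ext fun x ↦ by rw [← toSchwartz_apply, h4]; rfl)

theorem le_lintegral_localize {χ : 𝓓((⊤ : Opens E), ℂ)} (hm : Measurable h) (hh : MemLp h 2) :
    (∫⁻ ζ, ‖(m ζ : ℂ)⁻¹ * invTransform χ ζ‖ₑ ^ 2) * eLpNorm h 2 ^ 2 ≤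
      ∫⁻ y, eLpNorm (symbolMul w (invTransform (translate y χ)) h) 2 ^ 2 := by
  simp_rw [fourierInv_translate]
  exact hw.le_lintegral_symbolMul_modulate (invTransform χ).continuous.measurable hm hh
    (lintegral_growth_mul_sq_ne_top hw.growth' _)

/-- The difference is a symbol of `0`, so all its localizations vanish, and the lower bound
`le_lintegral_localize` forces its `L²` norm to be zero. -/
theorem isSymbol_unique {h' : E → ℂ} (hm : Measurable h)
    (hh : MemLp h 2) (hu : IsSymbol w u h)
    (hm' : Measurable h') (hh' : MemLp h' 2) (hu' : IsSymbol w u h') : h =ᵐ[volume] h' := by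
  obtain ⟨χ, hχ⟩ := exists_testFunction_ne_zero (E := E)
  have h0 := hw.isSymbol_zero_sub hh hh' hu hu'
  have h1 := hw.le_lintegral_localize (χ := χ) (hm.sub hm') (hh.sub hh')
  have h2 : ∀ y, symbolMul w (invTransform (translate y χ)) (h - h') = 0 := fun y ↦ by
    ext η
    rw [hw.symbolMul_eq_complexify (hh.sub hh') h0, complexify_apply]
    simp
  simp only [h2, eLpNorm_zero, ne_eq, OfNat.ofNat_ne_zero, not_false_eq_true, zero_pow,
    lintegral_zero, nonpos_iff_eq_zero, mul_eq_zero, hw.lintegral_inv_mul_sq_ne_zero hχ,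
    false_or, pow_eq_zero_iff] at h1
  rw [eLpNorm_eq_zero_iff (hh.sub hh').1 two_ne_zero] at h1
  filter_upwards [h1] with ξ hξ
  exact sub_eq_zero.1 hξ

end IsModerate

end Symbol

/-! ### Norms in terms of symbols -/

section Norms

variable {n : ℕ} {c : Composition n} {s : Fin c.length → ℝ}
  {u : 𝓓'((⊤ : Opens (EuclideanSpace ℝ (Fin n))), ℂ)} {h : EuclideanSpace ℝ (Fin n) → ℂ}

theorem sobolevENorm_eq (hm : Measurable h) (hh : MemLp h 2) (hu : IsSymbol (weight c s) u h) :
    sobolevENorm c s u = eLpNorm h 2 := by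
  have key : ∀ f : Lp ℂ 2 (volume : Measure (EuclideanSpace ℝ (Fin n))), HasBessel c s u f →
      ‖f‖ₑ = eLpNorm h 2 := fun f hf ↦ by
    have h1 := (isModerate_weight c s).isSymbol_unique (Lp.stronglyMeasurable _).measurable
      (Lp.memLp _) ((hasBessel_iff c s u f).1 hf) hm hh hu
    rw [← eLpNorm_congr_ae h1, ← Lp.enorm_def, ← ofReal_norm, ← ofReal_norm, Lp.norm_fourier_eq]
  obtain ⟨f, hf⟩ := (mem_sobolevSpace_iff_exists_isSymbol c s u).2 ⟨h, hm, hh, hu⟩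
  refine le_antisymm ((iInf₂_le f hf).trans_eq (key f hf)) ?_
  exact le_iInf₂ fun g hg ↦ (key g hg).ge

theorem smoothMul_mem_sobolevSpace (hu : u ∈ sobolevSpace c s)
    (ψ : 𝓓((⊤ : Opens (EuclideanSpace ℝ (Fin n))), ℂ)) :
    smoothMul ψ ψ.contDiff u ∈ sobolevSpace c s := by
  have hw := isModerate_weight c s
  obtain ⟨h, hm, hh, hu⟩ := (mem_sobolevSpace_iff_exists_isSymbol c s u).1 hu
  exact (mem_sobolevSpace_iff_exists_isSymbol c s _).2 ⟨_,
    measurable_symbolMul hw.continuous (invTransform ψ).continuous.measurable hm,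
    hw.memLp_symbolMul (invTransform ψ).continuous.measurable
      (lintegral_growth_mul_ne_top hw.growth' _) hm hh, hw.isSymbol_smoothMul hm hh hu ψ⟩

theorem sobolevENorm_smoothMul_eq (hm : Measurable h) (hh : MemLp h 2)
    (hu : IsSymbol (weight c s) u h) (ψ : 𝓓((⊤ : Opens (EuclideanSpace ℝ (Fin n))), ℂ)) :
    sobolevENorm c s (smoothMul ψ ψ.contDiff u) =
      eLpNorm (symbolMul (weight c s) (invTransform ψ) h) 2 := by
  have hw := isModerate_weight c s
  exact sobolevENorm_eq
    (measurable_symbolMul hw.continuous (invTransform ψ).continuous.measurable hm)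
    (hw.memLp_symbolMul (invTransform ψ).continuous.measurable
      (lintegral_growth_mul_ne_top hw.growth' _) hm hh) (hw.isSymbol_smoothMul hm hh hu ψ)

theorem sobolevENorm_smoothMul_le (hu : u ∈ sobolevSpace c s)
    (ψ : 𝓓((⊤ : Opens (EuclideanSpace ℝ (Fin n))), ℂ)) :
    sobolevENorm c s (smoothMul ψ ψ.contDiff u) ≤
      (∫⁻ ζ, ‖(moderator c s ζ : ℂ) * invTransform ψ ζ‖ₑ) * sobolevENorm c s u := by
  obtain ⟨h, hm, hh, hu⟩ := (mem_sobolevSpace_iff_exists_isSymbol c s u).1 hu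
  rw [sobolevENorm_smoothMul_eq hm hh hu, sobolevENorm_eq hm hh hu]
  exact (isModerate_weight c s).eLpNorm_symbolMul_le (invTransform ψ).continuous.measurable hm

theorem katoENorm_two_sq (χ : 𝓓((⊤ : Opens (EuclideanSpace ℝ (Fin n))), ℂ)) :
    katoENorm c s 2 χ u ^ 2 = ∫⁻ y, sobolevENorm c s (localize χ y u) ^ 2 := by
  rw [katoENorm, eLpNorm_two_sq]
  rfl

theorem katoENorm_two_sq_eq (hm : Measurable h) (hh : MemLp h 2)
    (hu : IsSymbol (weight c s) u h) (χ : 𝓓((⊤ : Opens (EuclideanSpace ℝ (Fin n))), ℂ)) :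
    katoENorm c s 2 χ u ^ 2 =
      ∫⁻ y, eLpNorm (symbolMul (weight c s) (invTransform (translate y χ)) h) 2 ^ 2 := by
  rw [katoENorm_two_sq]
  refine lintegral_congr fun y ↦ ?_
  rw [localize, sobolevENorm_smoothMul_eq hm hh hu]

theorem exists_le_sq_and_le_sq (x y : ℝ≥0) : ∃ C : ℝ≥0, 0 < C ∧ x ≤ C ^ 2 ∧ y ≤ C ^ 2 := by
  have h : x + y ≤ (1 + x + y) ^ 2 :=
    calc x + y ≤ 1 + x + y := by rw [add_assoc]; exact le_add_self
      _ ≤ _ := le_self_pow (by rw [add_assoc]; exact le_self_add) two_ne_zero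
  exact ⟨1 + x + y, by positivity, le_self_add.trans h, le_add_self.trans h⟩

theorem le_sq_mul_of_mul_le {b C : ℝ≥0} {x y : ℝ≥0∞} (hb : b ≠ 0) (hC : b⁻¹ ≤ C ^ 2)
    (h : b * x ≤ y) : x ≤ C ^ 2 * y := by
  have h1 : ((b⁻¹ : ℝ≥0) : ℝ≥0∞) ≤ C ^ 2 := by exact_mod_cast hC
  calc x = (b⁻¹ : ℝ≥0) * (b * x) := by
        rw [← mul_assoc, ← ENNReal.coe_mul, inv_mul_cancel₀ hb, ENNReal.coe_one, one_mul]
    _ ≤ C ^ 2 * y := mul_le_mul' h1 h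

/-- The equivalence of the norms of `ℋ^s` and `𝒦_2^s`. -/
theorem exists_norm_equiv (c : Composition n) (s : Fin c.length → ℝ)
    {χ : 𝓓((⊤ : Opens (EuclideanSpace ℝ (Fin n))), ℂ)} (hχ : χ ≠ 0) :
    ∃ C : ℝ≥0, 0 < C ∧ ∀ u ∈ sobolevSpace c s,
      sobolevENorm c s u ≤ C * katoENorm c s 2 χ u ∧
      katoENorm c s 2 χ u ≤ C * sobolevENorm c s u := by
  have hw := isModerate_weight c s
  -- Any finite positive `b` below the integral serves as lower constant, so finiteness of that
  -- integral need not be checked.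
  obtain ⟨b, hb0, hb⟩ := ENNReal.lt_iff_exists_nnreal_btwn.1
    (pos_iff_ne_zero.2 (hw.lintegral_inv_mul_sq_ne_zero hχ))
  rw [ENNReal.coe_pos] at hb0
  have hA := lintegral_growth_mul_sq_ne_top hw.growth' (invTransform χ)
  obtain ⟨A, hA'⟩ : ∃ A : ℝ≥0, (A : ℝ≥0∞) =
      ∫⁻ ζ, ‖(moderator c s ζ : ℂ) * invTransform χ ζ‖ₑ ^ 2 := ⟨_, ENNReal.coe_toNNReal hA⟩
  obtain ⟨C, hC0, hAC, hbC⟩ := exists_le_sq_and_le_sq A b⁻¹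
  refine ⟨C, hC0, fun u hu ↦ ?_⟩
  obtain ⟨h, hm, hh, hu⟩ := (mem_sobolevSpace_iff_exists_isSymbol c s u).1 hu
  have h1 := hw.le_lintegral_localize (χ := χ) hm hh
  have h2 : katoENorm c s 2 χ u ^ 2 ≤ A * eLpNorm h 2 ^ 2 := by
    rw [katoENorm_two_sq_eq hm hh hu, hA']
    simp_rw [fourierInv_translate]
    exact hw.lintegral_symbolMul_modulate_le (invTransform χ).continuous.measurable hm hh
      (lintegral_growth_mul_sq_ne_top hw.growth' _)
  rw [← katoENorm_two_sq_eq hm hh hu] at h1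
  rw [sobolevENorm_eq hm hh hu]
  constructor
  · refine (ENNReal.pow_le_pow_left_iff two_ne_zero).1 ?_
    rw [mul_pow]
    refine le_sq_mul_of_mul_le hb0.ne' hbC ((mul_le_mul_left hb.le _).trans h1)
  · refine (ENNReal.pow_le_pow_left_iff two_ne_zero).1 ?_
    rw [mul_pow]
    refine h2.trans (mul_le_mul_left ?_ _)
    exact_mod_cast hAC

theorem sobolevSpace_subset_katoSobolevSpace (c : Composition n) (s : Fin c.length → ℝ) :
    sobolevSpace c s ⊆ katoSobolevSpace c s 2 := by
  intro u hu
  have hw := isModerate_weight c s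
  obtain ⟨χ, hχ⟩ := exists_testFunction_ne_zero (E := EuclideanSpace ℝ (Fin n))
  refine ⟨χ, hχ, fun y ↦ smoothMul_mem_sobolevSpace hu _, ?_, ?_⟩
  · obtain ⟨h, hm, hh, hu⟩ := (mem_sobolevSpace_iff_exists_isSymbol c s u).1 hu
    -- `MemLp` also demands measurability in `y`, which the infimum defining the norm does not show
    -- but this square root of an integral does.
    have h1 : (fun y ↦ sobolevENorm c s (localize χ y u)) = fun y ↦
        (∫⁻ η, ‖symbolMul (weight c s) (modulate y (invTransform χ)) h η‖ₑ ^ 2) ^ (1 / 2 : ℝ) := by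
      ext y
      rw [localize, sobolevENorm_smoothMul_eq hm hh hu, fourierInv_translate, ← eLpNorm_two_sq,
        ← ENNReal.rpow_natCast, ← ENNReal.rpow_mul]
      norm_num
    rw [h1]
    have h2 : Measurable fun y ↦
        ∫⁻ η, ‖symbolMul (weight c s) (modulate y (invTransform χ)) h η‖ₑ ^ 2 :=
      Measurable.lintegral_prod_right' ((measurable_symbolMul_modulate hw.continuous
        (invTransform χ).continuous.measurable hm).enorm.pow_const 2)
    exact (h2.pow_const _).aestronglyMeasurable
  · obtain ⟨C, -, hC⟩ := exists_norm_equiv c s hχ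
    refine (hC u hu).2.trans_lt (ENNReal.mul_lt_top ENNReal.coe_lt_top ?_)
    exact ((mem_sobolevSpace_iff c s u).1 hu).lt_top

end Norms

/-! ### Cutoffs -/

section Cutoff

variable {E : Type*} [NormedAddCommGroup E] [NormedSpace ℝ E]

/-- `S` may vanish away from the closed support of `f`, but there the product is locally zero. -/
theorem contDiff_mul_div {f g S : E → ℂ} (hf : ContDiff ℝ ∞ f) (hg : ContDiff ℝ ∞ g)
    (hS : ContDiff ℝ ∞ S) (hfS : ∀ x ∈ tsupport f, S x ≠ 0) :
    ContDiff ℝ ∞ fun x ↦ f x * (g x / S x) := by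
  refine contDiff_iff_contDiffAt.2 fun x ↦ ?_
  by_cases hx : x ∈ tsupport f
  · simp_rw [div_eq_mul_inv]
    exact hf.contDiffAt.mul (hg.contDiffAt.mul (hS.contDiffAt.inv (hfS x hx)))
  · refine (contDiffAt_const (c := (0 : ℂ))).congr_of_eventuallyEq ?_
    filter_upwards [(isClosed_tsupport f).isOpen_compl.mem_nhds hx] with z hz
    rw [image_eq_zero_of_notMem_tsupport hz, zero_mul]

/-- The dilation `ψ (x / R)` of a test function. -/
def dilate (R : ℝ) (hR : R ≠ 0) (ψ : 𝓓((⊤ : Opens E), ℂ)) : 𝓓((⊤ : Opens E), ℂ) where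
  toFun x := ψ (R⁻¹ • x)
  contDiff' := ψ.contDiff.comp (contDiff_id.const_smul R⁻¹)
  hasCompactSupport' :=
    ψ.hasCompactSupport.comp_homeomorph (Homeomorph.smulOfNeZero R⁻¹ (inv_ne_zero hR))
  tsupport_subset' := Set.subset_univ _

theorem smoothMul_apply_of_eq_one (ψ : 𝓓((⊤ : Opens E), ℂ)) (u : 𝓓'((⊤ : Opens E), ℂ))
    (φ : 𝓓((⊤ : Opens E), ℝ)) (h : ∀ x, φ x ≠ 0 → ψ x = 1) :
    smoothMul ψ ψ.contDiff u φ = u φ := by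
  have h1 : ∀ x, φ x * ψ x = φ x := fun x ↦ by
    by_cases hx : φ x = 0
    · simp [hx]
    · rw [h x hx, mul_one]
  have h2 : TestFunction.postcompCLM Complex.reCLM (testMul ψ ψ.contDiff φ) = φ := by
    ext x
    simp [testMul_apply, h1]
  have h3 : TestFunction.postcompCLM Complex.imCLM (testMul ψ ψ.contDiff φ) = 0 := by
    ext x
    simp [testMul_apply, h1]
  rw [smoothMul_apply, h2, h3, map_zero, mul_zero, add_zero]

theorem exists_cutoff [FiniteDimensional ℝ E] :
    ∃ ψ : 𝓓((⊤ : Opens E), ℂ), ∀ x, ‖x‖ ≤ 1 → ψ x = 1 := by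
  let f : ContDiffBump (0 : E) := ⟨1, 2, one_pos, one_lt_two⟩
  refine ⟨⟨fun x ↦ (f x : ℂ), Complex.ofRealCLM.contDiff.comp f.contDiff,
    f.hasCompactSupport.comp_left Complex.ofReal_zero, Set.subset_univ _⟩, fun x hx ↦ ?_⟩
  change (f x : ℂ) = 1
  rw [f.one_of_mem_closedBall (by simpa using hx), Complex.ofReal_one]

/-- Convergence of the cut-off distributions to `u` is eventual equality on each test function. The
factor `k + 1` is at least `1` for every `k`, as `lintegral_dilate_le` requires. -/
theorem eventually_smoothMul_dilate_apply {ψ : 𝓓((⊤ : Opens E), ℂ)}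
    (hψ : ∀ x, ‖x‖ ≤ 1 → ψ x = 1) (u : 𝓓'((⊤ : Opens E), ℂ)) (φ : 𝓓((⊤ : Opens E), ℝ)) :
    ∀ᶠ k : ℕ in Filter.atTop, smoothMul (dilate (k + 1) k.cast_add_one_ne_zero ψ)
      (dilate (k + 1) k.cast_add_one_ne_zero ψ).contDiff u φ = u φ := by
  obtain ⟨r, hr⟩ := φ.hasCompactSupport.isCompact.isBounded.exists_norm_le
  filter_upwards [Filter.eventually_ge_atTop ⌈r⌉₊] with k hk
  refine smoothMul_apply_of_eq_one _ _ _ fun x hx ↦ hψ _ ?_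
  have h1 := hr x (subset_tsupport _ hx)
  have h2 : r ≤ k := Nat.ceil_le.1 hk
  rw [norm_smul, norm_inv, Real.norm_of_nonneg (by positivity), inv_mul_le_iff₀ (by positivity)]
  linarith

end Cutoff

/-! ### Multiplier bounds uniform under dilation -/

section Dilation

variable {E : Type*} [NormedAddCommGroup E] [InnerProductSpace ℝ E] [FiniteDimensional ℝ E]
  [MeasurableSpace E] [BorelSpace E]

theorem invTransform_dilate {R : ℝ} (hR : 0 < R) (ψ : 𝓓((⊤ : Opens E), ℂ)) (ζ : E) :
    invTransform (dilate R hR.ne' ψ) ζ =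
      (R ^ Module.finrank ℝ E : ℝ) * invTransform ψ (R • ζ) := by
  have h := Measure.integral_comp_inv_smul (volume : Measure E)
    (fun x ↦ Complex.exp (↑(2 * Real.pi * inner ℝ x (R • ζ)) * Complex.I) • ψ x) R
  rw [abs_of_pos (by positivity), Complex.real_smul] at h
  rw [invTransform, invTransform, SchwartzMap.fourierInv_coe, SchwartzMap.fourierInv_coe,
    Real.fourierInv_eq', Real.fourierInv_eq']
  refine Eq.trans (integral_congr_ae (.of_forall fun x ↦ ?_)) h
  dsimp only
  rw [inner_smul_left, inner_smul_right]
  have h1 : (starRingEnd ℝ) R⁻¹ * (R * inner ℝ x ζ) = inner ℝ x ζ := by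
    rw [starRingEnd_apply, star_trivial, inv_mul_cancel_left₀ hR.ne']
  rw [h1]
  rfl

theorem lintegral_comp_smul (R : ℝ) (hR : 0 < R) {f : E → ℝ≥0∞} (hf : Measurable f) :
    ENNReal.ofReal (R ^ Module.finrank ℝ E) * ∫⁻ x, f (R • x) = ∫⁻ x, f x := by
  have h := lintegral_map (μ := (volume : Measure E)) hf (measurable_const_smul R)
  rw [← h, Measure.map_addHaar_smul _ hR.ne', lintegral_smul_measure, smul_eq_mul, ← mul_assoc,
    ← ENNReal.ofReal_mul (by positivity), abs_of_pos (by positivity),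
    mul_inv_cancel₀ (by positivity), ENNReal.ofReal_one, one_mul]

/-- Dilation by `R ≥ 1` concentrates the transform near the origin with unchanged `L¹` norm, and `m`
is smaller there: substitute `R ζ` and use `m(ζ) ≤ m(R ζ)`. -/
theorem IsModerate.lintegral_dilate_le {w m : E → ℝ} (hw : IsModerate w m) {R : ℝ} (hR : 1 ≤ R)
    (hR0 : R ≠ 0) (ψ : 𝓓((⊤ : Opens E), ℂ)) :
    ∫⁻ ζ, ‖(m ζ : ℂ) * invTransform (dilate R hR0 ψ) ζ‖ₑ ≤
      ∫⁻ ζ, ‖(m ζ : ℂ) * invTransform ψ ζ‖ₑ := by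
  have hR1 : 0 < R := one_pos.trans_le hR
  have hmm := hw.measurable_weight_mul (invTransform ψ).continuous.measurable
  rw [← lintegral_comp_smul R hR1 hmm,
    ← lintegral_const_mul (f := fun ζ ↦ ‖(m (R • ζ) : ℂ) * invTransform ψ (R • ζ)‖ₑ) _
      (hmm.comp (measurable_const_smul R))]
  refine lintegral_mono fun ζ ↦ ?_
  have h1 : ‖(m ζ : ℂ)‖ₑ ≤ ‖(m (R • ζ) : ℂ)‖ₑ := by
    rw [enorm_le_iff_norm_le, Complex.norm_real, Complex.norm_real,
      Real.norm_of_nonneg (hw.pos' _).le, Real.norm_of_nonneg (hw.pos' _).le]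
    exact hw.le_smul R ζ hR
  have h2 : ‖((R ^ Module.finrank ℝ E : ℝ) : ℂ)‖ₑ = ENNReal.ofReal (R ^ Module.finrank ℝ E) := by
    rw [← ofReal_norm, Complex.norm_real, Real.norm_of_nonneg (by positivity)]
  rw [invTransform_dilate hR1, enorm_mul, enorm_mul, enorm_mul, h2, mul_left_comm]
  gcongr

end Dilation

/-! ### Weak limits -/

/-- Banach–Alaoglu along an ultrafilter, so no subsequence or separability is needed. Only pairings
that are eventually constant have to be followed. -/
theorem exists_weak_limit {H : Type*} [NormedAddCommGroup H] [InnerProductSpace ℂ H]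
    [CompleteSpace H] {x : ℕ → H} {M : ℝ} (hx : ∀ k, ‖x k‖ ≤ M) :
    ∃ x₀ : H, ∀ y z, (∀ᶠ k in Filter.atTop, inner ℂ y (x k) = z) → inner ℂ y x₀ = z := by
  let X : ℕ → WeakDual ℂ H := fun k ↦ StrongDual.toWeakDual (InnerProductSpace.toDual ℂ H (x k))
  let U : Ultrafilter ℕ := Filter.hyperfilter ℕ
  have hX : ∀ k, X k ∈ WeakDual.toStrongDual ⁻¹' Metric.closedBall (0 : StrongDual ℂ H) M := by
    intro k
    change InnerProductSpace.toDual ℂ H (x k) ∈ Metric.closedBall 0 M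
    rw [mem_closedBall_zero_iff, LinearIsometryEquiv.norm_map]
    exact hx k
  obtain ⟨l, -, hl⟩ := (WeakDual.isCompact_closedBall (𝕜 := ℂ) (E := H) 0 M).ultrafilter_le_nhds
    (U.map X) (Filter.le_principal_iff.2 (Ultrafilter.mem_map.2 (Filter.univ_mem' hX)))
  refine ⟨(InnerProductSpace.toDual ℂ H).symm (WeakDual.toStrongDual l), fun y z hz ↦ ?_⟩
  have h1 : Filter.Tendsto (fun k ↦ X k y) U (nhds (l y)) :=
    ((WeakDual.eval_continuous y).tendsto l).comp hl
  -- The functional `X k` takes `y` to `⟪x k, y⟫`, the conjugate of the pairing in the statement.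
  have h2 : Filter.Tendsto (fun k ↦ X k y) U (nhds (starRingEnd ℂ z)) := by
    refine tendsto_const_nhds.congr' ?_
    have h3 : (U : Filter ℕ) ≤ Filter.atTop := by
      rw [← Nat.cofinite_eq_atTop]; exact Filter.hyperfilter_le_cofinite
    filter_upwards [h3 hz] with k hk
    rw [← hk, inner_conj_symm]
    rfl
  have h4 := tendsto_nhds_unique h1 h2
  rw [← inner_conj_symm, InnerProductSpace.toDual_symm_apply]
  change starRingEnd ℂ (l y) = z
  rw [h4, Complex.conj_conj]

/-! ### From local to global -/

section Global

variable {n : ℕ} {c : Composition n} {s : Fin c.length → ℝ}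
  {u : 𝓓'((⊤ : Opens (EuclideanSpace ℝ (Fin n))), ℂ)}

theorem mem_sobolevSpace_of_eq_sum {ι : Type*} (t : Finset ι)
    {v : ι → 𝓓'((⊤ : Opens (EuclideanSpace ℝ (Fin n))), ℂ)} (hv : ∀ i, v i ∈ sobolevSpace c s)
    (hu : ∀ φ, u φ = ∑ i ∈ t, v i φ) : u ∈ sobolevSpace c s := by
  simp only [mem_sobolevSpace_iff_exists_isSymbol] at hv ⊢
  choose k hkm hk hkv using hv
  have hm : Measurable (∑ i ∈ t, k i) := by fun_prop
  exact ⟨_, hm, memLp_finsetSum' _ fun i _ ↦ hk i,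
    (isModerate_weight c s).isSymbol_sum t (fun i _ ↦ hk i) (fun i _ ↦ hkv i) hu⟩

/-- Finitely many translates `χ_p` of `χ` have no common zero on the support of `ψ`, so `ψ = ∑ a_p
χ_p` with `a_p = ψ · conj χ_p / ∑ |χ_q|²`, and each `a_p (χ_p u)` lies in `ℋ^s`. -/
theorem smoothMul_mem_sobolevSpace_of_localize
    {χ : 𝓓((⊤ : Opens (EuclideanSpace ℝ (Fin n))), ℂ)} (hχ : χ ≠ 0)
    (hu : ∀ y, localize χ y u ∈ sobolevSpace c s)
    (ψ : 𝓓((⊤ : Opens (EuclideanSpace ℝ (Fin n))), ℂ)) :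
    smoothMul ψ ψ.contDiff u ∈ sobolevSpace c s := by
  obtain ⟨x₀, hx₀⟩ : ∃ x, χ x ≠ 0 := by
    by_contra! h
    exact hχ (TestFunction.ext h)
  have htr : ∀ y x, translate y χ x = χ (x - y) := fun _ _ ↦ rfl
  -- The shift `p - x₀` moves the point `x₀`, where `χ` does not vanish, to `p`.
  obtain ⟨t, -, ht⟩ := (ψ.hasCompactSupport.isCompact).elim_nhds_subcover
    (fun p ↦ {x | translate (p - x₀) χ x ≠ 0}) (fun p _ ↦
      (isOpen_ne_fun (translate (p - x₀) χ).continuous continuous_const).mem_nhds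
        (by simpa [htr] using hx₀))
  let S : EuclideanSpace ℝ (Fin n) → ℂ := fun x ↦
    ∑ p ∈ t, starRingEnd ℂ (translate (p - x₀) χ x) * translate (p - x₀) χ x
  have hconj : ∀ p, ContDiff ℝ ∞ fun x ↦ starRingEnd ℂ (translate (p - x₀) χ x) := fun p ↦
    Complex.conjCLE.contDiff.comp (translate (p - x₀) χ).contDiff
  have hS : ContDiff ℝ ∞ S :=
    ContDiff.sum fun p _ ↦ (hconj p).mul (translate (p - x₀) χ).contDiff
  have hS0 : ∀ x ∈ tsupport ψ, S x ≠ 0 := fun x hx h0 ↦ by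
    obtain ⟨p, hp, hpx⟩ := Set.mem_iUnion₂.1 (ht hx)
    have h1 : S x = ((∑ p ∈ t, Complex.normSq (translate (p - x₀) χ x) : ℝ) : ℂ) := by
      rw [Complex.ofReal_sum]
      exact Finset.sum_congr rfl fun p _ ↦ (Complex.normSq_eq_conj_mul_self).symm
    rw [h1, Complex.ofReal_eq_zero, Finset.sum_eq_zero_iff_of_nonneg
      fun _ _ ↦ Complex.normSq_nonneg _] at h0
    exact hpx (Complex.normSq_eq_zero.1 (h0 p hp))
  let a : EuclideanSpace ℝ (Fin n) → 𝓓((⊤ : Opens (EuclideanSpace ℝ (Fin n))), ℂ) := fun p ↦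
    ⟨fun x ↦ ψ x * (starRingEnd ℂ (translate (p - x₀) χ x) / S x),
      contDiff_mul_div ψ.contDiff (hconj p) hS hS0, ψ.hasCompactSupport.mul_right,
      Set.subset_univ _⟩
  have hsum : ∀ x, ψ x = ∑ p ∈ t, testProd (a p) (translate (p - x₀) χ) x := fun x ↦ by
    have h1 : ∑ p ∈ t, testProd (a p) (translate (p - x₀) χ) x = ψ x * (S x / S x) := by
      rw [Finset.sum_div, Finset.mul_sum]
      refine Finset.sum_congr rfl fun p _ ↦ ?_
      change ψ x * (starRingEnd ℂ (translate (p - x₀) χ x) / S x) * _ = _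
      ring
    rw [h1]
    by_cases hx : x ∈ tsupport ψ
    · rw [div_self (hS0 x hx), mul_one]
    · rw [image_eq_zero_of_notMem_tsupport hx, zero_mul]
  refine mem_sobolevSpace_of_eq_sum t (v := fun p ↦
    smoothMul (testProd (a p) (translate (p - x₀) χ))
      (testProd (a p) (translate (p - x₀) χ)).contDiff u) (fun p ↦ ?_)
    (smoothMul_apply_eq_sum t ψ _ hsum u)
  rw [← smoothMul_smoothMul]
  exact smoothMul_mem_sobolevSpace (hu (p - x₀)) (a p)

/-- Multiplication by `ψ` commutes with localization, so the `ℋ^s` multiplier bound applies for each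
`y` separately. -/
theorem katoENorm_smoothMul_le {χ : 𝓓((⊤ : Opens (EuclideanSpace ℝ (Fin n))), ℂ)}
    (hu : ∀ y, localize χ y u ∈ sobolevSpace c s)
    (ψ : 𝓓((⊤ : Opens (EuclideanSpace ℝ (Fin n))), ℂ)) :
    katoENorm c s 2 χ (smoothMul ψ ψ.contDiff u) ≤
      (∫⁻ ζ, ‖(moderator c s ζ : ℂ) * invTransform ψ ζ‖ₑ) * katoENorm c s 2 χ u := by
  have hA := lintegral_growth_mul_ne_top (isModerate_weight c s).growth' (invTransform ψ)
  refine (ENNReal.pow_le_pow_left_iff two_ne_zero).1 ?_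
  rw [mul_pow, katoENorm_two_sq, katoENorm_two_sq, ← lintegral_const_mul' _ _
    (ENNReal.pow_ne_top hA)]
  refine lintegral_mono fun y ↦ ?_
  rw [← mul_pow, localize, smoothMul_comm]
  exact pow_le_pow_left' (sobolevENorm_smoothMul_le (hu y) ψ) 2

theorem mem_sobolevSpace_of_bounded_of_eventually
    {v : ℕ → 𝓓'((⊤ : Opens (EuclideanSpace ℝ (Fin n))), ℂ)} (hv : ∀ k, v k ∈ sobolevSpace c s)
    {M : ℝ≥0∞} (hM : M ≠ ⊤) (hvM : ∀ k, sobolevENorm c s (v k) ≤ M)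
    (hu : ∀ φ, ∀ᶠ k in Filter.atTop, v k φ = u φ) : u ∈ sobolevSpace c s := by
  have hw := isModerate_weight c s
  simp only [mem_sobolevSpace_iff_exists_isSymbol] at hv ⊢
  choose h hm hh hvh using hv
  obtain ⟨f, hf⟩ := exists_weak_limit (x := fun k ↦ (hh k).toLp (h k)) (M := M.toReal)
    fun k ↦ by
      rw [Lp.norm_toLp]
      refine ENNReal.toReal_mono hM ?_
      rw [← sobolevENorm_eq (hm k) (hh k) (hvh k)]
      exact hvM k
  refine ⟨f, (Lp.stronglyMeasurable f).measurable, Lp.memLp f, fun φ ↦ ?_⟩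
  have hg := memLp_growth_mul hw.growth_inv (𝓕⁻ (testToSchwartz φ)) 2
  -- The symbol integral is an `L²` inner product with the fixed function `w⁻¹ 𝓕⁻ φ`, hence passes
  -- to weak limits; the `star` offsets conjugate-linearity in the first slot.
  have hinner : ∀ (k : EuclideanSpace ℝ (Fin n) → ℂ) (F : Lp ℂ 2 volume), F =ᵐ[volume] k →
      inner ℂ (hg.star.toLp _) F =
        ∫ ξ, k ξ * (weight c s ξ : ℂ)⁻¹ * 𝓕⁻ (testToSchwartz φ) ξ := fun k F hF ↦ by
    rw [L2.inner_def]
    refine integral_congr_ae ?_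
    filter_upwards [hg.star.coeFn_toLp, hF] with ξ h1 h2
    rw [h1, h2, Pi.star_apply, RCLike.inner_apply, ← starRingEnd_apply, RCLike.conj_conj]
    ring
  rw [← hinner f f (.refl _ _)]
  refine (hf _ _ ?_).symm
  filter_upwards [hu φ] with k hk
  rw [← hk, hvh k φ, hinner (h k) _ (hh k).coeFn_toLp]

theorem katoSobolevSpace_subset_sobolevSpace (c : Composition n) (s : Fin c.length → ℝ) :
    katoSobolevSpace c s 2 ⊆ sobolevSpace c s := by
  rintro u ⟨χ, hχ, hu, hu2⟩
  have hw := isModerate_weight c s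
  obtain ⟨ψ, hψ⟩ := exists_cutoff (E := EuclideanSpace ℝ (Fin n))
  obtain ⟨C, -, hC⟩ := exists_norm_equiv c s hχ
  have hmem := smoothMul_mem_sobolevSpace_of_localize hχ hu
  -- The bound `M` combines the equivalence constant, applied to the cut-off distributions, with the
  -- multiplier norm of the undilated `ψ`; it does not depend on `k`.
  refine mem_sobolevSpace_of_bounded_of_eventually
    (v := fun k : ℕ ↦ smoothMul (dilate (k + 1) k.cast_add_one_ne_zero ψ)
      (dilate (k + 1) k.cast_add_one_ne_zero ψ).contDiff u)
    (M := C * ((∫⁻ ζ, ‖(moderator c s ζ : ℂ) * invTransform ψ ζ‖ₑ) * katoENorm c s 2 χ u))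
    (fun k ↦ hmem _) ?_ (fun k ↦ ?_) (eventually_smoothMul_dilate_apply hψ u)
  · exact ENNReal.mul_ne_top ENNReal.coe_ne_top (ENNReal.mul_ne_top
      (lintegral_growth_mul_ne_top hw.growth' _) hu2.eLpNorm_ne_top)
  · refine (hC _ (hmem _)).1.trans ?_
    gcongr
    refine (katoENorm_smoothMul_le hu _).trans (mul_le_mul_left ?_ _)
    exact hw.lintegral_dilate_le (by linarith [(k.cast_nonneg : (0 : ℝ) ≤ k)]) _ ψ

end Global
end KatoSobolev
end

theorem mainTheorem5 {n : ℕ} (c : Composition n) (s : Fin c.length → ℝ) :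
    KatoSobolev.sobolevSpace c s = KatoSobolev.katoSobolevSpace c s 2 ∧
    ∀ χ : 𝓓((⊤ : Opens (EuclideanSpace ℝ (Fin n))), ℂ), χ ≠ 0 →
      ∃ C : ℝ≥0, 0 < C ∧ ∀ u ∈ KatoSobolev.sobolevSpace c s,
        KatoSobolev.sobolevENorm c s u ≤ C * KatoSobolev.katoENorm c s 2 χ u ∧
        KatoSobolev.katoENorm c s 2 χ u ≤ C * KatoSobolev.sobolevENorm c s u :=
  ⟨(KatoSobolev.sobolevSpace_subset_katoSobolevSpace c s).antisymm
    (KatoSobolev.katoSobolevSpace_subset_sobolevSpace c s),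
    fun _ hχ ↦ KatoSobolev.exists_norm_equiv c s hχ⟩
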